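/- Let a finite game be given with players $[N]$, nonempty finite action sets $\mathcal A_i$, joint action set $\mathcal A=\prod_i\mathcal A_i$, utilities $\mathcal U_i:\mathcal A\to[0,1]$ and a set $\mathcal S$ of nonempty coalitions $S\subseteq[N]$; write $\mathcal A_S=\prod_{i\in S}\mathcal A_i$ and $A=\max_i|\mathcal A_i|$. For $\pi$ in the simplex $\Delta^{\mathcal A}$ and a probability vector $\mu$ on the set of pairs $(S,\hat a_S)$ with $S\in\mathcal S$ and $\hat a_S\in\mathcal A_S$, let \[F(\pi,\mu)=\sum_{S\in\mathcal S}\sum_{\hat a_S\in\mathcal A_S}\frac{\mu(S,\hat a_S)}{|S|}\sum_{i\in S}\mathbb E_{a\sim\pi}\bigl[\mathcal U_i(\hat a_S,a_{-S})-\mathcal U_i(a)\bigr].\] Let $\mathcal N(i)$ be the set of players whose action can affect $\mathcal U_i$, and let $\mathcal G$ be the graph on $[N]$ in which $i\ne j$ are adjacent iff $i,j\in\mathcal N(k)$ for some $k$. Let $\mathcal T$ be a tree decomposition of $\mathcal G$ with $|\mathcal T|$ bags and width $w=\max_{B\in\mathcal T}|B|-1$, and let $\eta>0$. In round $t=1,2,\dots$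 the correlator draws independent noise variables $n^{(t)}(B,a_B)\sim\mathrm{Exp}(\eta)$ (rate $\eta$) for all bags $B\in\mathcal T$ and all $a_B\in\mathcal A_B$, puts $\tilde n^{(t)}(a)=\sum_{B\in\mathcal T}n^{(t)}(B,a_B)$, and plays \[\pi^{(t)}\in\operatorname*{argmin}_{\pi\in\Delta^{\mathcal A}}\ \sum_{\tau=1}^{t-1}F(\pi,\mu^{(\tau)})-\langle\tilde n^{(t)},\pi\rangle .\] The deviator is adaptive and plays $\mu^{(t)}$: the noise $n^{(t)}$ is independent of $\bigl(n^{(1)},\dots,n^{(t-1)},\mu^{(1)},\dots,\mu^{(t)}\bigr)$. (In particular the deviator may itself follow the perturbed leader with its own independent noise.) (a) For every $T$ and every $\delta>0$, with probability at least $1-\delta$, \[\max_{\hat\pi\in\Delta^{\mathcal A}}\sum_{t=1}^T\Bigl(F(\pi^{(t)},\mu^{(t)})-F(\hat\pi,\mu^{(t)})\Bigr)\le 2|\mathcal T|\,\frac{1+(w+1)\log A}{\eta}+2\eta|\mathcal T|T+\sqrt{2T\log\tfrac1\delta}\] (the bound is trivial for $\delta\ge1$, where the square root is read as $0$). In particular,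 if $\mathcal T$ has minimum width, the bound holds with $w=\mathrm{tw}(\mathcal G)$, the treewidth of $\mathcal G$. (b) The update is computed by dynamic programming over $\mathcal T$. Root $\mathcal T$ at any bag $B^r$, let $C(B)$ be the set of children of $B$, and assign each player $i$ to any bag that contains $\mathcal N(i)$, so that $\mathcal U_i(a_B)$ makes sense for $i$ assigned to $B$. Define \[d^{(t)}(B,a_B)=\sum_{\tau=1}^{t-1}\sum_{S\in\mathcal S}\frac1{|S|}\sum_{\substack{i\in S\\ i\text{ assigned to }B}}\sum_{\hat a_S\in\mathcal A_S}\mu^{(\tau)}(S,\hat a_S)\bigl(\mathcal U_i(\hat a_{S\cap B},a_{B\setminus S})-\mathcal U_i(a_B)\bigr)+\sum_{B'\in C(B)}\ \min_{\substack{a'_{B'}\in\mathcal A_{B'}\\ a'_{B\cap B'}=a_{B\cap B'}}}d^{(t)}(B',a'_{B'})-n^{(t)}(B,a_B).\] There is a joint action $a\in\mathcal A$ such that $a_{B^r}$ minimizes $d^{(t)}(B^r,\cdot)$ and, for every bag $B$ and every $B'\in C(B)$, $a_{B'}$ minimizes $d^{(t)}(B',\cdot)$ among the joint actions of the players of $B'$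 that agree with $a$ on $B\cap B'$; and for every such $a$ the pure strategy concentrated on $a$ belongs to the $\operatorname{argmin}$ defining $\pi^{(t)}$. -/

import Mathlib

open MeasureTheory ProbabilityTheory

noncomputable section

namespace CoalitionGame

universe u v

/-- A joint action `a_B` of the players in `B`. -/
abbrev PartialProfile {N : ℕ} (A : Fin N → Type u) (B : Finset (Fin N)) : Type u :=
  (i : B) → A i

/-- A finite game with players `Fin N`, action sets `A i`, utilities in `[0, 1]`, and a set of
(nonempty) coalitions. -/
structure Game {N : ℕ} (A : Fin N → Type u) where
  utility : Fin N → ((i : Fin N) → A i) → ℝ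
  utility_mem : ∀ i a, utility i a ∈ Set.Icc (0 : ℝ) 1
  coalitions : Finset (Finset (Fin N))
  coalition_nonempty : ∀ S ∈ coalitions, S.Nonempty

/-- The joint action `(b_B, a_{-B})`. -/
def override {N : ℕ} {A : Fin N → Type u} {B : Finset (Fin N)} (b : PartialProfile A B)
    (a : (i : Fin N) → A i) : (i : Fin N) → A i :=
  fun i => if h : i ∈ B then b ⟨i, h⟩ else a i

/-- An arbitrary completion of `a_B` to a joint action of all players. -/
def extend {N : ℕ} {A : Fin N → Type u} [∀ i, Nonempty (A i)] {B : Finset (Fin N)}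
    (b : PartialProfile A B) : (i : Fin N) → A i :=
  override b fun _ => Classical.arbitrary _

/-- The size of the largest action set. -/
def maxActions {N : ℕ} (A : Fin N → Type u) [∀ i, Fintype (A i)] : ℕ :=
  Finset.univ.sup fun i => Fintype.card (A i)

/-! ### Tree decompositions -/

/-- A tree decomposition of `G` whose bags are indexed by the nodes `κ` of a tree. -/
structure TreeDecomposition {V : Type u} (G : SimpleGraph V) (κ : Type v) where
  tree : SimpleGraph κ
  isTree : tree.IsTree
  bag : κ → Finset V
  cover : ∀ i, ∃ k, i ∈ bag k
  edge : ∀ i j, G.Adj i j → ∃ k, i ∈ bag k ∧ j ∈ bag k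
  path : ∀ (i : V) (k l : κ), i ∈ bag k → i ∈ bag l →
    ∀ p : tree.Walk k l, p.IsPath → ∀ m ∈ p.support, i ∈ bag m

namespace TreeDecomposition

variable {V : Type u} {G : SimpleGraph V} {κ : Type v}

/-- The size of the largest bag minus one. -/
def width [Fintype κ] (D : TreeDecomposition G κ) : ℕ :=
  (Finset.univ.sup fun k => (D.bag k).card) - 1

/-- `l` is a child of `k` when the tree is rooted at `r`. -/
def IsChild (D : TreeDecomposition G κ) (r k l : κ) : Prop :=
  D.tree.Adj k l ∧ D.tree.dist r l = D.tree.dist r k + 1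

theorem dist_lt_card [Fintype κ] (D : TreeDecomposition G κ) (r k : κ) :
    D.tree.dist r k < Fintype.card κ := by
  obtain ⟨p, hp, hl⟩ := (D.isTree.connected r k).exists_path_of_dist
  exact hl ▸ hp.length_lt

end TreeDecomposition

/-- The least width of a (finite) tree decomposition. -/
def treewidth {V : Type u} (G : SimpleGraph V) : ℕ :=
  sInf {w | ∃ (K : ℕ) (D : TreeDecomposition G (Fin K)), D.width = w}

namespace Game

variable {N : ℕ} {A : Fin N → Type u}

/-- The players whose action can affect the utility of player `i`. -/
def relevant (G : Game A) (i : Fin N) : Set (Fin N) :=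
  {j | ∃ (a : (i : Fin N) → A i) (x y : A j),
    G.utility i (Function.update a j x) ≠ G.utility i (Function.update a j y)}

/-- The utility dependence graph. -/
def dependenceGraph (G : Game A) : SimpleGraph (Fin N) where
  Adj i j := i ≠ j ∧ ∃ k, i ∈ G.relevant k ∧ j ∈ G.relevant k
  symm := ⟨fun _ _ h => ⟨h.1.symm, h.2.imp fun _ hk => ⟨hk.2, hk.1⟩⟩⟩
  loopless := ⟨fun _ h => h.1 rfl⟩

/-- The pure strategies `(S, â_S)` of the deviator. -/
abbrev Deviation (G : Game A) : Type u :=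
  (S : G.coalitions) × PartialProfile A S.1

variable [∀ i, Fintype (A i)]

/-- `F(π, μ)`, the expected average gain of the deviating coalition. -/
def payoff (G : Game A) (π : ((i : Fin N) → A i) → ℝ) (μ : G.Deviation → ℝ) : ℝ :=
  ∑ p : G.Deviation, μ p / (p.1.1.card : ℝ) *
    ∑ i ∈ p.1.1, ∑ a, π a * (G.utility i (override p.2 a) - G.utility i a)

variable {κ : Type v}

/-- The coordinates `(B, a_B)` of the noise vector: a bag and a joint action of its players. -/
abbrev NoiseIndex (G : Game A) (D : TreeDecomposition G.dependenceGraph κ) : Type (max u v) :=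
  (k : κ) × PartialProfile A (D.bag k)

variable [Fintype κ]

/-- The noise `ñ(a) = ∑_B n(B, a_B)` of the joint action `a`. -/
def totalNoise (G : Game A) (D : TreeDecomposition G.dependenceGraph κ)
    (n : G.NoiseIndex D → ℝ) (a : (i : Fin N) → A i) : ℝ :=
  ∑ k, n ⟨k, (D.bag k).restrict a⟩

/-- `π` is a possible follow-the-perturbed-leader decision after the `t` deviator strategies
`μ 0, …, μ (t - 1)`: a minimizer over the simplex of `∑_{s < t} F(·, μ s) - ⟨ñ, ·⟩`. -/
def IsFTPLUpdate (G : Game A) (D : TreeDecomposition G.dependenceGraph κ)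
    (μ : ℕ → G.Deviation → ℝ) (t : ℕ) (n : G.NoiseIndex D → ℝ)
    (π : ((i : Fin N) → A i) → ℝ) : Prop :=
  π ∈ stdSimplex ℝ ((i : Fin N) → A i) ∧
  IsMinOn (fun ρ => ∑ s ∈ Finset.range t, G.payoff ρ (μ s) - ∑ a, G.totalNoise D n a * ρ a)
    (stdSimplex ℝ ((i : Fin N) → A i)) π

variable [∀ i, Nonempty (A i)]

/-- The contribution to `d(B, b)` of the players assigned to the bag `B` (node `k`). -/
def localCost (G : Game A) (D : TreeDecomposition G.dependenceGraph κ) [DecidableEq κ]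
    (assign : Fin N → κ) (μ : ℕ → G.Deviation → ℝ) (t : ℕ)
    (k : κ) (b : PartialProfile A (D.bag k)) : ℝ :=
  ∑ s ∈ Finset.range t, ∑ p : G.Deviation, μ s p / (p.1.1.card : ℝ) *
    ∑ i ∈ p.1.1 with assign i = k,
      (G.utility i (override p.2 (extend b)) - G.utility i (extend b))

open Classical in
/-- The dynamic program `d(B, b)` on the tree rooted at `r`: the local cost, plus for every child
`B'` the least value of `d(B', b')` over the `b'` agreeing with `b` on `B ∩ B'`, minus the noise.
The infimum is over a finite nonempty set. -/
def dpTable (G : Game A) (D : TreeDecomposition G.dependenceGraph κ)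
    (r : κ) (assign : Fin N → κ) (μ : ℕ → G.Deviation → ℝ) (t : ℕ) (n : G.NoiseIndex D → ℝ)
    (k : κ) (b : PartialProfile A (D.bag k)) : ℝ :=
  G.localCost D assign μ t k b
    + (∑ l : {l : κ // D.IsChild r k l},
        (⨅ b' : {b' : PartialProfile A (D.bag l.1) //
          ∀ (i : Fin N) (h : i ∈ D.bag k) (h' : i ∈ D.bag l.1), b' ⟨i, h'⟩ = b ⟨i, h⟩},
          dpTable G D r assign μ t n l.1 b'.1))
    - n ⟨k, b⟩
termination_by Fintype.card κ - D.tree.dist r k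
decreasing_by
  have h1 := l.2.2
  have h2 := D.dist_lt_card r l.1
  omega

/-- `a` is a joint action reconstructed from the dynamic program, from the root to the leaves, with
any tie-breaking: on the root bag it minimizes `d`, and on every child bag `B'` of a bag `B` it
minimizes `d(B', ·)` among the joint actions of `B'` that agree with `a` on `B ∩ B'`. -/
def IsDPOutput (G : Game A) (D : TreeDecomposition G.dependenceGraph κ)
    (r : κ) (assign : Fin N → κ) (μ : ℕ → G.Deviation → ℝ) (t : ℕ) (n : G.NoiseIndex D → ℝ)
    (a : (i : Fin N) → A i) : Prop :=
  (∀ b, G.dpTable D r assign μ t n r ((D.bag r).restrict a) ≤ G.dpTable D r assign μ t n r b) ∧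
  ∀ k l, D.IsChild r k l → ∀ b : PartialProfile A (D.bag l),
    (∀ (i : Fin N) (h : i ∈ D.bag l), i ∈ D.bag k → b ⟨i, h⟩ = a i) →
      G.dpTable D r assign μ t n l ((D.bag l).restrict a) ≤ G.dpTable D r assign μ t n l b

/-- The regret bound for a tree decomposition with `K` bags of size at most `w + 1`, largest action
set of size `m`, noise parameter `η`, horizon `T` and confidence `δ`. -/
def regretBound (K w m T : ℕ) (η δ : ℝ) : ℝ :=
  2 * K * ((1 + (w + 1) * Real.log m) / η) + 2 * η * K * T + Real.sqrt (2 * T * Real.log (1 / δ))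

end Game

end CoalitionGame

end

/-! ### Exponential noise -/

/-! The payoff is linear in the correlator's strategy, so the update is follow the perturbed leader
over joint actions, with costs in `[-1, 1]` and with the noise of an action equal to the sum over
its features `(B, a_B)`, one for each of the `K` bags.

For a fixed cost sequence, being the leader with hindsight of one round loses at most the expected
maximal noise (`be_the_leader`). This is bounded bag by bag through exponential moments, which is
where the width enters (`integral_noiseBound_le`). Lacking that round of hindsight costs `2ηK` per
round (`integral_minimizer_sub_le`): raising the noise on the features of `a` by slightly more than
`2` keeps `a` the leader after a cost change of at most `1` per action, and `Exp(η)` pays a factor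
`exp(ηv)` for a shift by `v`.

Only expectations occur there, so one noise vector can replace the fresh ones, and the bound holds
along every realized deviator sequence. The realized costs differ from these expectations by a sum
of conditionally centred bounded increments, because each noise is independent of the past and of
the current deviation. Hoeffding's lemma makes the sum sub-Gaussian
(`hasSubgaussianMGF_sum_of_indepFun`). The comparator does not enter this sum, so one event serves
all comparators.

For the dynamic program, summing the recursion over all bags cancels every table entry except that
of the root, giving equality for an output and an inequality for any other action
(`IsDPOutput.isMin`). -/

/-- `Measure.pi` comes from the largest outer measure below the product of the measures of the
projections, and that product is monotone. -/
theorem pi_mono_of_le {ι : Type*} [Fintype ι] {X : ι → Type*} [∀ i, MeasurableSpace (X i)]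
    {μ ν : ∀ i, Measure (X i)} (h : ∀ i, μ i ≤ ν i) : Measure.pi μ ≤ Measure.pi ν := by
  refine Measure.le_iff.2 fun s hs => ?_
  rw [Measure.pi, Measure.pi, toMeasure_apply _ _ hs, toMeasure_apply _ _ hs]
  refine (OuterMeasure.le_boundedBy.2 fun t => ?_) s
  refine (OuterMeasure.boundedBy_le _).trans ?_
  exact Finset.prod_le_prod' fun i _ => (Measure.le_iff'.1 (h i)) _

theorem pi_smul_eq {ι : Type*} [Fintype ι] {X : ι → Type*} [∀ i, MeasurableSpace (X i)]
    (μ : ∀ i, Measure (X i)) [∀ i, IsFiniteMeasure (μ i)] (c : ι → NNReal) :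
    Measure.pi (fun i => c i • μ i) = (∏ i, c i) • Measure.pi μ := by
  refine Measure.pi_eq fun s _ => ?_
  simp only [Measure.smul_apply, Measure.pi_pi, ENNReal.smul_def, smul_eq_mul,
    Finset.prod_mul_distrib, ENNReal.ofNNReal_finsetProd]

/-- On `x ≥ 0` the density at `x` is exactly `exp (η * v)` times the density at `x + v`; for `x < 0`
it vanishes. -/
theorem expMeasure_map_add_le {η v : ℝ} (hv : 0 ≤ v) :
    (expMeasure η).map (· + v) ≤ (Real.exp (η * v)).toNNReal • expMeasure η := by
  refine Measure.le_iff.2 fun s hs => ?_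
  rw [Measure.map_apply (measurable_add_const v) hs, Measure.smul_apply]
  have hm : Measurable (exponentialPDF η) := (measurable_exponentialPDFReal η).ennreal_ofReal
  have key : ∀ t, MeasurableSet t → expMeasure η t = ∫⁻ x in t, exponentialPDF η x :=
    fun t ht => withDensity_apply _ ht
  rw [key _ hs, key _ ((measurable_add_const v) hs), ENNReal.smul_def, smul_eq_mul,
    ← lintegral_const_mul _ hm, ← lintegral_indicator hs,
    ← lintegral_indicator ((measurable_add_const v) hs)]
  rw [← lintegral_add_right_eq_self (μ := volume)
    (s.indicator fun a => ((Real.exp (η * v)).toNNReal : ENNReal) * exponentialPDF η a) v]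
  refine lintegral_mono fun x => ?_
  by_cases hx : x + v ∈ s
  · rw [Set.indicator_of_mem (by exact hx), Set.indicator_of_mem hx]
    rcases lt_or_ge x 0 with h | h
    · simp [exponentialPDF_of_neg h]
    · rw [exponentialPDF_of_nonneg h, exponentialPDF_of_nonneg (add_nonneg h hv)]
      change _ ≤ ENNReal.ofReal _ * _
      rw [← ENNReal.ofReal_mul (Real.exp_pos _).le]
      refine ENNReal.ofReal_le_ofReal (le_of_eq ?_)
      rw [mul_left_comm, ← Real.exp_add]
      ring_nf
  · rw [Set.indicator_of_notMem (by exact hx), Set.indicator_of_notMem hx]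

/-- The law of a vector of independent `Exp(η)` variables. -/
noncomputable abbrev expNoise (I : Type*) [Fintype I] (η : ℝ) : Measure (I → ℝ) :=
  Measure.pi fun _ => expMeasure η

theorem isProbabilityMeasure_expNoise (I : Type*) [Fintype I] {η : ℝ} (hη : 0 < η) :
    IsProbabilityMeasure (expNoise I η) :=
  have := isProbabilityMeasure_expMeasure hη
  inferInstance

theorem expNoise_shift_le {I : Type*} [Fintype I] {η : ℝ} (hη : 0 < η) (v : I → ℝ)
    (hv : ∀ i, 0 ≤ v i) {E E' : Set (I → ℝ)} (hE' : MeasurableSet E')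
    (h : ∀ n ∈ E, n + v ∈ E') :
    (expNoise I η).real E ≤ Real.exp (η * ∑ i, v i) * (expNoise I η).real E' := by
  have := isProbabilityMeasure_expMeasure hη
  have h1 : (expNoise I η).map (fun n i => n i + v i)
      ≤ (∏ i, (Real.exp (η * v i)).toNNReal) • expNoise I η := by
    have : ∀ i, IsProbabilityMeasure ((expMeasure η).map (· + v i)) := fun i =>
      Measure.isProbabilityMeasure_map (measurable_add_const _).aemeasurable
    rw [Measure.pi_map_pi fun i => (measurable_add_const (v i)).aemeasurable, ← pi_smul_eq]
    exact pi_mono_of_le fun i => expMeasure_map_add_le (hv i)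
  have hm : Measurable fun (n : I → ℝ) i => n i + v i := by fun_prop
  have h2 := (measure_mono (μ := expNoise I η)
    (show E ⊆ (fun (n : I → ℝ) i => n i + v i) ⁻¹' E' from h)).trans
    ((Measure.map_apply hm hE').symm.le.trans (Measure.le_iff'.1 h1 E'))
  have h3 := ENNReal.toReal_mono (measure_ne_top _ _) h2
  rw [Measure.smul_apply, ENNReal.smul_def, smul_eq_mul, ENNReal.toReal_mul] at h3
  refine h3.trans (le_of_eq ?_)
  congr 1
  simp [Finset.mul_sum, Real.exp_sum, (Real.exp_pos _).le]

/-- Tilting the `Exp(η)` density by `exp (η / 2 * x)` gives twice the `Exp(η / 2)` density. -/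
theorem lintegral_exp_half_expMeasure {η : ℝ} (hη : 0 < η) :
    ∫⁻ x, ENNReal.ofReal (Real.exp (η / 2 * x)) ∂expMeasure η = 2 := by
  have hm : Measurable (exponentialPDF η) := (measurable_exponentialPDFReal η).ennreal_ofReal
  have hm' : Measurable (exponentialPDF (η / 2)) :=
    (measurable_exponentialPDFReal _).ennreal_ofReal
  change ∫⁻ x, ENNReal.ofReal (Real.exp (η / 2 * x)) ∂volume.withDensity (exponentialPDF η) = 2
  rw [lintegral_withDensity_eq_lintegral_mul _ hm (by fun_prop)]
  have : ∀ x, (exponentialPDF η * fun x => ENNReal.ofReal (Real.exp (η / 2 * x))) x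
      = 2 * exponentialPDF (η / 2) x := by
    intro x
    rcases lt_or_ge x 0 with h | h
    · simp [exponentialPDF_of_neg h]
    · rw [Pi.mul_apply, exponentialPDF_of_nonneg h, exponentialPDF_of_nonneg h,
        ← ENNReal.ofReal_mul (by positivity), ← ENNReal.ofReal_ofNat 2,
        ← ENNReal.ofReal_mul (by positivity), mul_assoc, ← Real.exp_add]
      congr 1
      ring_nf
  simp_rw [this]
  rw [lintegral_const_mul _ hm', lintegral_exponentialPDF_eq_one (by positivity), mul_one]

theorem integrable_exp_half_expMeasure {η : ℝ} (hη : 0 < η) :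
    Integrable (fun x => Real.exp (η / 2 * x)) (expMeasure η) := by
  refine ⟨by fun_prop, ?_⟩
  rw [hasFiniteIntegral_iff_ofReal (Filter.Eventually.of_forall fun x => (Real.exp_pos _).le),
    lintegral_exp_half_expMeasure hη]
  simp

theorem integral_exp_half_expMeasure {η : ℝ} (hη : 0 < η) :
    ∫ x, Real.exp (η / 2 * x) ∂expMeasure η = 2 := by
  rw [integral_eq_lintegral_of_nonneg_ae (Filter.Eventually.of_forall fun x => (Real.exp_pos _).le)
    (by fun_prop), lintegral_exp_half_expMeasure hη]
  simp

theorem expMeasure_ae_nonneg (η : ℝ) : ∀ᵐ x ∂expMeasure η, 0 ≤ x := by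
  have hm : Measurable (exponentialPDF η) := (measurable_exponentialPDFReal η).ennreal_ofReal
  change ∀ᵐ x ∂volume.withDensity (exponentialPDF η), 0 ≤ x
  rw [ae_withDensity_iff hm]
  refine Filter.Eventually.of_forall fun x hx => ?_
  by_contra h
  exact hx (exponentialPDF_of_neg (not_le.1 h))

theorem integral_exp_half_expNoise {I : Type*} [Fintype I] {η : ℝ} (hη : 0 < η) (i : I) :
    ∫ n, Real.exp (η / 2 * n i) ∂expNoise I η = 2 := by
  have := isProbabilityMeasure_expMeasure hη
  rw [integral_comp_eval (μ := fun _ : I => expMeasure η) (f := fun x => Real.exp (η / 2 * x))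
    (by fun_prop), integral_exp_half_expMeasure hη]

theorem integrable_exp_half_expNoise {I : Type*} [Fintype I] {η : ℝ} (hη : 0 < η) (i : I) :
    Integrable (fun n : I → ℝ => Real.exp (η / 2 * n i)) (expNoise I η) := by
  have := isProbabilityMeasure_expMeasure hη
  exact (measurePreserving_eval (fun _ : I => expMeasure η) i).integrable_comp_of_integrable
    (integrable_exp_half_expMeasure hη)

theorem expNoise_ae_nonneg {I : Type*} [Fintype I] {η : ℝ} (hη : 0 < η) :
    ∀ᵐ n ∂expNoise I η, ∀ i, 0 ≤ n i := by
  have := isProbabilityMeasure_expMeasure hη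
  refine ae_all_iff.2 fun i => ?_
  exact (measurePreserving_eval (fun _ : I => expMeasure η) i).quasiMeasurePreserving.ae
    (expMeasure_ae_nonneg η)

/-- The maximum of `M` numbers is bounded by their exponential moments. -/
theorem le_log_add_sum_exp {β : Type*} [Fintype β] {η : ℝ} (hη : 0 < η) (x : β → ℝ) (b : β) :
    x b ≤ 2 / η * (Real.log (2 * Fintype.card β) - 1
      + (∑ b', Real.exp (η / 2 * x b')) / (2 * Fintype.card β)) := by
  have : Nonempty β := ⟨b⟩
  have hM : (0 : ℝ) < 2 * Fintype.card β := by positivity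
  -- The normalizer `2 * card β` is the mean of the exponential sum when the `x b'` are `Exp(η)`, so
  -- the last term then has mean `1` and cancels the `-1`.
  have h1 := Real.log_le_sub_one_of_pos (div_pos (Real.exp_pos (η / 2 * x b)) hM)
  rw [Real.log_div (Real.exp_pos _).ne' hM.ne', Real.log_exp] at h1
  have h2 : Real.exp (η / 2 * x b) ≤ ∑ b', Real.exp (η / 2 * x b') :=
    Finset.single_le_sum (f := fun b' => Real.exp (η / 2 * x b'))
      (fun _ _ => (Real.exp_pos _).le) (Finset.mem_univ b)
  have h3 := div_le_div_of_nonneg_right h2 hM.le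
  have h4 : η / 2 * x b ≤ Real.log (2 * Fintype.card β) - 1
      + (∑ b', Real.exp (η / 2 * x b')) / (2 * Fintype.card β) := by linarith
  calc x b = 2 / η * (η / 2 * x b) := by field_simp
    _ ≤ _ := by gcongr

/-! ### Follow the perturbed leader over a finite set of actions -/

/-- Take the first admissible index in an enumeration of `ι`. -/
theorem exists_measurable_selection {X ι : Type*} [MeasurableSpace X] [Finite ι] (S : ι → Set X)
    (hS : ∀ a, MeasurableSet (S a)) (hcover : ∀ x, ∃ a, x ∈ S a) :
    ∃ g : X → ι, (∀ x, x ∈ S (g x)) ∧ ∀ a, MeasurableSet {x | g x = a} := by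
  classical
  obtain ⟨m, ⟨e⟩⟩ := Finite.exists_equiv_fin ι
  let p : X → ℕ → Prop := fun x k => ∃ h : k < m, x ∈ S (e.symm ⟨k, h⟩)
  have hp : ∀ x, ∃ k, p x k := fun x => by
    obtain ⟨a, ha⟩ := hcover x
    exact ⟨e a, (e a).2, by simpa using ha⟩
  have hm : Measurable fun x => Nat.find (hp x) := by
    refine measurable_find hp fun k => ?_
    by_cases hk : k < m
    · simpa [p, hk] using hS (e.symm ⟨k, hk⟩)
    · simp [p, hk]
  refine ⟨fun x => e.symm ⟨Nat.find (hp x), (Nat.find_spec (hp x)).1⟩,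
    fun x => (Nat.find_spec (hp x)).2, fun a => ?_⟩
  convert hm (measurableSet_singleton (e a : ℕ)) using 1
  ext x
  simp [Equiv.symm_apply_eq, Fin.ext_iff]

/-- A measurable choice of a minimizer of `x`, with ties broken in favour of large values of `c`. -/
structure LeaderSelection (ι : Type*) where
  leader : (ι → ℝ) → (ι → ℝ) → ι
  measurableSet_eq : ∀ a, MeasurableSet {p : (ι → ℝ) × (ι → ℝ) | leader p.1 p.2 = a}
  le : ∀ (x c : ι → ℝ) (a : ι), x (leader x c) ≤ x a
  tie_le : ∀ (x c : ι → ℝ) (a : ι), (∀ a', x a ≤ x a') → c a ≤ c (leader x c)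

theorem nonempty_leaderSelection (ι : Type*) [Finite ι] [Nonempty ι] :
    Nonempty (LeaderSelection ι) := by
  obtain ⟨g, hg, hm⟩ := exists_measurable_selection
    (fun a => {p : (ι → ℝ) × (ι → ℝ) | ∀ a', p.1 a ≤ p.1 a' ∧ (p.1 a' ≤ p.1 a → p.2 a' ≤ p.2 a)})
    (fun a => by
      simp only [Set.ofPred_forall, Set.ofPred_and, imp_iff_not_or, Set.ofPred_or, not_le]
      refine MeasurableSet.iInter fun a' => .inter ?_ (.union ?_ ?_)
      · exact measurableSet_le (by fun_prop) (by fun_prop)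
      · exact measurableSet_lt (by fun_prop) (by fun_prop)
      · exact measurableSet_le (by fun_prop) (by fun_prop))
    (fun p => by
      obtain ⟨a₀, h₀⟩ := Finite.exists_min p.1
      have : Nonempty {a // p.1 a ≤ p.1 a₀} := ⟨⟨a₀, le_rfl⟩⟩
      obtain ⟨⟨a, ha⟩, hmax⟩ := Finite.exists_max fun a : {a // p.1 a ≤ p.1 a₀} => p.2 a
      exact ⟨a, fun a' => ⟨ha.trans (h₀ a'), fun h => hmax ⟨a', h.trans ha⟩⟩⟩)
  exact ⟨⟨fun x c => g (x, c), hm, fun x c a => (hg (x, c) a).1,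
    fun x c a h => (hg (x, c) a).2 (h _)⟩⟩

theorem LeaderSelection.measurableSet_comp {ι X : Type*} [MeasurableSpace X]
    (L : LeaderSelection ι) {x c : X → ι → ℝ} (hx : Measurable x) (hc : Measurable c) (a : ι) :
    MeasurableSet {y | L.leader (x y) (c y) = a} :=
  (hx.prodMk hc) (L.measurableSet_eq a)

theorem LeaderSelection.measurable_apply {ι X : Type*} [Finite ι] [MeasurableSpace X]
    (L : LeaderSelection ι) {x c d : X → ι → ℝ} (hx : Measurable x) (hc : Measurable c)
    (hd : Measurable d) : Measurable fun y => d y (L.leader (x y) (c y)) := by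
  classical
  have := Fintype.ofFinite ι
  have h : (fun y => d y (L.leader (x y) (c y)))
      = fun y => ∑ a, {y | L.leader (x y) (c y) = a}.indicator (fun y => d y a) y := by
    ext y
    simp [Set.indicator_apply]
  rw [h]
  exact Finset.measurable_sum _ fun a _ =>
    Measurable.indicator (by fun_prop) (L.measurableSet_comp hx hc a)

/-- The perturbed cost `x(a) - ∑_{j ∈ F a} n_j` of the action `a`. -/
def perturbedCost {ι I : Type*} (F : ι → Finset I) (x : ι → ℝ) (n : I → ℝ) (a : ι) : ℝ :=
  x a - ∑ j ∈ F a, n j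

theorem measurable_perturbedCost {ι I X : Type*} [MeasurableSpace X] (F : ι → Finset I)
    {x : X → ι → ℝ} {n : X → I → ℝ} (hx : Measurable x) (hn : Measurable n) :
    Measurable fun y => perturbedCost F (x y) (n y) := by
  unfold perturbedCost
  fun_prop

/-- The noise acts as the cost of a round before the first. In the induction step, the hypothesis is
applied to the leader that already knows round `T`. -/
theorem be_the_leader {ι I : Type*} (L : LeaderSelection ι) (F : ι → Finset I) (c : ℕ → ι → ℝ) (n : I → ℝ)
    (T : ℕ) (a : ι) :
    ∑ t ∈ Finset.range T,
        c t (L.leader (perturbedCost F (∑ s ∈ Finset.range (t + 1), c s) n) 0)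
      - ∑ j ∈ F (L.leader (perturbedCost F 0 n) 0), n j
      ≤ perturbedCost F (∑ s ∈ Finset.range T, c s) n a := by
  induction T generalizing a with
  | zero => simpa [perturbedCost] using L.le (perturbedCost F 0 n) 0 a
  | succ T ih =>
    have h1 := L.le (perturbedCost F (∑ s ∈ Finset.range (T + 1), c s) n) 0 a
    have h2 := ih (L.leader (perturbedCost F (∑ s ∈ Finset.range (T + 1), c s) n) 0)
    refine le_trans ?_ h1
    generalize hb : L.leader (perturbedCost F (∑ s ∈ Finset.range (T + 1), c s) n) 0 = b at h2
    rw [Finset.sum_range_succ, hb]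
    have h3 : perturbedCost F (∑ s ∈ Finset.range (T + 1), c s) n b
        = perturbedCost F (∑ s ∈ Finset.range T, c s) n b + c T b := by
      simp only [perturbedCost, Finset.sum_range_succ, Pi.add_apply]
      ring
    linarith

/-! ### Stability of the perturbed leader and its expected regret -/

section Stability

variable {ι I : Type*} [Fintype I] {F : ι → Finset I} {K : ℕ} {η : ℝ}

/-- Adding `s` to the noise on `F a` lowers the perturbed cost of `a` by `s * K`, and that of any
other action by at most `s * (K - 1)`. The gained margin `s > 2` beats the change from `C` to `C'`,
strictly, so tie-breaking is irrelevant. -/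
theorem measureReal_minimizer_le (hη : 0 < η) (hF : ∀ a a', F a ⊆ F a' → a = a')
    (hK : ∀ a, (F a).card = K) {C C' : ι → ℝ} (hC : ∀ a, |C' a - C a| ≤ 1)
    {p q : (I → ℝ) → ι} (hp : ∀ n a, perturbedCost F C n (p n) ≤ perturbedCost F C n a)
    (hq : ∀ n a, perturbedCost F C' n (q n) ≤ perturbedCost F C' n a)
    (hqm : ∀ a, MeasurableSet {n | q n = a}) {s : ℝ} (hs : 2 < s) (a : ι) :
    (expNoise I η).real {n | p n = a}
      ≤ Real.exp (η * (s * K)) * (expNoise I η).real {n | q n = a} := by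
  classical
  let v : I → ℝ := fun j => if j ∈ F a then s else 0
  have hv : ∀ j, 0 ≤ v j := fun j => by dsimp only [v]; split_ifs <;> linarith
  have hvs : ∀ j, v j ≤ s := fun j => by dsimp only [v]; split_ifs <;> linarith
  have hva : ∑ j ∈ F a, v j = s * K := by
    rw [Finset.sum_congr rfl fun j hj => if_pos hj, Finset.sum_const, hK, nsmul_eq_mul, mul_comm]
  have hsum : ∑ j, v j = s * K := by
    rw [← hva, ← Finset.sum_subset (Finset.subset_univ (F a))]
    exact fun j _ hj => if_neg hj
  rw [← hsum]
  refine expNoise_shift_le hη v hv (hqm a) fun n hn => ?_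
  by_contra hne
  have h1 := hp n (q (n + v))
  have h2 := hq (n + v) a
  rw [Set.mem_ofPred_eq] at hn hne
  rw [hn] at h1
  generalize q (n + v) = b at h1 h2 hne
  -- The competitor `b` has a feature outside `F a`, which the shift does not reach.
  obtain ⟨j, hj, hj'⟩ := Finset.not_subset.1 fun h => hne (hF b a h)
  have hvb : ∑ j ∈ F b, v j + s ≤ s * K := by
    rw [← Finset.add_sum_erase _ _ hj]
    have h3 := Finset.sum_le_card_nsmul ((F b).erase j) v s fun j _ => hvs j
    rw [nsmul_eq_mul, Finset.card_erase_of_mem hj, hK,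
      Nat.cast_pred (by rw [← hK b]; exact Finset.card_pos.2 ⟨j, hj⟩)] at h3
    have h4 : v j = 0 := if_neg hj'
    linarith
  simp only [perturbedCost, Pi.add_apply, Finset.sum_add_distrib] at h1 h2
  have h5 := abs_le.1 (hC a)
  have h6 := abs_le.1 (hC b)
  linarith [h5.1, h5.2, h6.1, h6.2]

theorem integral_comp_eq_sum {X : Type*} [MeasurableSpace X] [Fintype ι] (ν : Measure X)
    [IsFiniteMeasure ν] {p : X → ι} (hp : ∀ a, MeasurableSet {n | p n = a}) (c : ι → ℝ) :
    ∫ n, c (p n) ∂ν = ∑ a, c a * ν.real {n | p n = a} := by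
  classical
  have h : (fun n => c (p n)) = fun n => ∑ a, {n | p n = a}.indicator (fun _ => c a) n := by
    ext n
    simp [Set.indicator_apply]
  rw [h, integral_finsetSum _ fun a _ => (integrable_const _).indicator (hp a)]
  exact Finset.sum_congr rfl fun a _ => by
    rw [integral_indicator_const _ (hp a), smul_eq_mul, mul_comm]

theorem integrable_comp {X : Type*} [MeasurableSpace X] [Fintype ι] (ν : Measure X)
    [IsFiniteMeasure ν] {p : X → ι} (hp : ∀ a, MeasurableSet {n | p n = a}) (c : ι → ℝ) :
    Integrable (fun n => c (p n)) ν := by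
  classical
  have h : (fun n => c (p n)) = fun n => ∑ a, {n | p n = a}.indicator (fun _ => c a) n := by
    ext n
    simp [Set.indicator_apply]
  rw [h]
  exact integrable_finsetSum _ fun a _ => (integrable_const _).indicator (hp a)

/-- If two nonnegative numbers have ratio at most `exp (2 x)`, their difference is at most
`tanh x ≤ x` times their sum. -/
theorem abs_sub_le_mul_add {x p q : ℝ} (hx : 0 ≤ x) (hp0 : 0 ≤ p) (hq0 : 0 ≤ q)
    (hp : p ≤ Real.exp (2 * x) * q)
    (hq : q ≤ Real.exp (2 * x) * p) : |p - q| ≤ x * (p + q) := by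
  wlog h : q ≤ p generalizing p q
  · rw [abs_sub_comm, add_comm]
    exact this hq0 hp0 hq hp (le_of_not_ge h)
  rw [abs_of_nonneg (sub_nonneg.2 h)]
  rcases le_or_gt 1 x with h1 | h1
  · nlinarith
  · have h2 : Real.exp (2 * x) * (1 - x) ≤ 1 + x := by
      -- Keep only the first term `2 * x` of the series of `log (1 + x) - log (1 - x)`.
      have h3 : Real.exp (2 * x) ≤ (1 + x) / (1 - x) := by
        rw [← Real.le_log_iff_exp_le (div_pos (by linarith) (by linarith)),
          Real.log_div (by linarith) (by linarith)]
        have h4 := (Real.hasSum_log_sub_log_of_abs_lt_one (x := x) (abs_lt.2 ⟨by linarith, h1⟩))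
        have h5 := h4.summable.sum_le_tsum {0} fun i _ => by positivity
        rw [h4.tsum_eq] at h5
        simpa using h5
      rwa [le_div_iff₀ (by linarith)] at h3
    nlinarith [mul_le_mul_of_nonneg_right hp (sub_nonneg.2 h1.le)]

/-- The probability ratios bound the total variation. The additive form of `abs_sub_le_mul_add` sums
over actions to `s * η * K`, since both laws have mass `1`. -/
theorem integral_minimizer_sub_le [Fintype ι] (hη : 0 < η) (hF : ∀ a a', F a ⊆ F a' → a = a')
    (hK : ∀ a, (F a).card = K) {C C' : ι → ℝ} (hC : ∀ a, |C' a - C a| ≤ 1)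
    {p q : (I → ℝ) → ι} (hp : ∀ n a, perturbedCost F C n (p n) ≤ perturbedCost F C n a)
    (hq : ∀ n a, perturbedCost F C' n (q n) ≤ perturbedCost F C' n a)
    (hpm : ∀ a, MeasurableSet {n | p n = a}) (hqm : ∀ a, MeasurableSet {n | q n = a})
    {c : ι → ℝ} (hc : ∀ a, |c a| ≤ 1) :
    ∫ n, c (p n) ∂expNoise I η ≤ ∫ n, c (q n) ∂expNoise I η + 2 * η * K := by
  have := isProbabilityMeasure_expNoise I hη
  set P : ι → ℝ := fun a => (expNoise I η).real {n | p n = a} with hP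
  set Q : ι → ℝ := fun a => (expNoise I η).real {n | q n = a} with hQ
  have hP1 : ∑ a, P a = 1 := by
    have := integral_comp_eq_sum (expNoise I η) hpm fun _ => 1
    simpa using this.symm
  have hQ1 : ∑ a, Q a = 1 := by
    have := integral_comp_eq_sum (expNoise I η) hqm fun _ => 1
    simpa using this.symm
  have key : ∀ s : ℝ, 2 < s → ∑ a, c a * P a - ∑ a, c a * Q a ≤ s * (η * K) := by
    intro s hs
    calc ∑ a, c a * P a - ∑ a, c a * Q a = ∑ a, c a * (P a - Q a) := by
          rw [← Finset.sum_sub_distrib]; simp_rw [mul_sub]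
      _ ≤ ∑ a, (s * (η * K) / 2) * (P a + Q a) := by
          refine Finset.sum_le_sum fun a _ => ?_
          have h1 : |P a - Q a| ≤ (s * (η * K) / 2) * (P a + Q a) := by
            refine abs_sub_le_mul_add (by positivity) measureReal_nonneg measureReal_nonneg ?_ ?_
            · rw [show 2 * (s * (η * K) / 2) = η * (s * K) by ring]
              exact measureReal_minimizer_le hη hF hK hC hp hq hqm hs a
            · rw [show 2 * (s * (η * K) / 2) = η * (s * K) by ring]
              exact measureReal_minimizer_le hη hF hK
                (fun a => by rw [abs_sub_comm]; exact hC a) hq hp hpm hs a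
          calc c a * (P a - Q a) ≤ |c a * (P a - Q a)| := le_abs_self _
            _ = |c a| * |P a - Q a| := abs_mul _ _
            _ ≤ 1 * |P a - Q a| := by gcongr; exact hc a
            _ ≤ _ := by rwa [one_mul]
      _ = s * (η * K) := by
          rw [← Finset.mul_sum, Finset.sum_add_distrib, hP1, hQ1]; ring
  rw [integral_comp_eq_sum _ hpm, integral_comp_eq_sum _ hqm]
  have h2 : ∑ a, c a * P a - ∑ a, c a * Q a ≤ 2 * (η * K) := by
    -- The shift needs `s > 2`; the sharp constant is recovered as `s` decreases to `2`.
    have hcont : Filter.Tendsto (fun s : ℝ => s * (η * K)) (nhdsWithin 2 (Set.Ioi 2))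
        (nhds (2 * (η * K))) :=
      ((continuous_id.mul continuous_const).tendsto 2).mono_left nhdsWithin_le_nhds
    exact ge_of_tendsto hcont (by filter_upwards [self_mem_nhdsWithin] with s hs using key s hs)
  linarith

/-- The expected cost `c` of the perturbed leader for the past costs `x`. -/
noncomputable def expectedCost (L : LeaderSelection ι) (F : ι → Finset I) (η : ℝ) (x c : ι → ℝ) :
    ℝ :=
  ∫ n, c (L.leader (perturbedCost F x n) c) ∂expNoise I η

/-- Stability replaces each round's leader by the one that also knows that round; then
`be_the_leader` is integrated with the same `n` in all rounds. The comparator's noise is nonnegative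
and is dropped. -/
theorem sum_expectedCost_le [Fintype ι] (L : LeaderSelection ι) (hη : 0 < η)
    (hF : ∀ a a', F a ⊆ F a' → a = a') (hK : ∀ a, (F a).card = K) {c : ℕ → ι → ℝ}
    (hc : ∀ t a, |c t a| ≤ 1) {R : (I → ℝ) → ℝ} (hR : Integrable R (expNoise I η))
    (hRle : ∀ n a, ∑ j ∈ F a, n j ≤ R n) (T : ℕ) (a : ι) :
    ∑ t ∈ Finset.range T, expectedCost L F η (∑ s ∈ Finset.range t, c s) (c t)
      ≤ ∑ t ∈ Finset.range T, c t a + ∫ n, R n ∂expNoise I η + 2 * η * K * T := by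
  have := isProbabilityMeasure_expNoise I hη
  have hm : ∀ (x d : ι → ℝ) (b : ι),
      MeasurableSet {n : I → ℝ | L.leader (perturbedCost F x n) d = b} := fun x d b =>
    L.measurableSet_comp (measurable_perturbedCost F measurable_const measurable_id)
      measurable_const b
  set q : ℕ → (I → ℝ) → ι := fun t n =>
    L.leader (perturbedCost F (∑ s ∈ Finset.range (t + 1), c s) n) 0 with hq
  have h1 : ∀ t, expectedCost L F η (∑ s ∈ Finset.range t, c s) (c t)
      ≤ ∫ n, c t (q t n) ∂expNoise I η + 2 * η * K := fun t => by
    refine integral_minimizer_sub_le hη hF hK (C' := ∑ s ∈ Finset.range (t + 1), c s) (fun b => ?_)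
      (fun n b => L.le _ _ b) (fun n b => L.le _ _ b) (hm _ _) (hm _ _) (hc t)
    rw [Finset.sum_range_succ, Pi.add_apply, add_sub_cancel_left]
    exact hc t b
  have h2 : ∫ n, ∑ t ∈ Finset.range T, c t (q t n) ∂expNoise I η
      ≤ ∫ n, (∑ t ∈ Finset.range T, c t a + R n) ∂expNoise I η := by
    refine integral_mono_ae
      (integrable_finsetSum _ fun t _ => integrable_comp _ (hm _ _) (c t))
      ((integrable_const _).add hR) ?_
    filter_upwards [expNoise_ae_nonneg (I := I) hη] with n hn
    have h3 := be_the_leader L F c n T a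
    have h4 := hRle n (L.leader (perturbedCost F 0 n) 0)
    have h5 : 0 ≤ ∑ j ∈ F a, n j := Finset.sum_nonneg fun j _ => hn j
    rw [perturbedCost, Finset.sum_apply] at h3
    linarith
  rw [integral_finsetSum _ fun t _ => integrable_comp _ (hm _ _) (c t),
    integral_add (integrable_const _) hR, integral_const, probReal_univ, one_smul] at h2
  calc _ ≤ ∑ t ∈ Finset.range T, (∫ n, c t (q t n) ∂expNoise I η + 2 * η * K) :=
        Finset.sum_le_sum fun t _ => h1 t
    _ = ∑ t ∈ Finset.range T, ∫ n, c t (q t n) ∂expNoise I η + 2 * η * K * T := by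
        rw [Finset.sum_add_distrib, Finset.sum_const, Finset.card_range, nsmul_eq_mul]; ring
    _ ≤ _ := by linarith

end Stability

/-! ### A concentration inequality for fresh independent noise -/

/-- Given `H`, the variable `Z` still has law `ν`, so the increment is centred. By Fubini its moment
generating function is integrated first and contributes a factor `exp (t ^ 2 / 2)`. -/
theorem hasSubgaussianMGF_add_of_indepFun {Ω X Y : Type*} [MeasurableSpace Ω] [MeasurableSpace X]
    [MeasurableSpace Y] {P : Measure Ω} [IsProbabilityMeasure P] {ν : Measure Y}
    [IsProbabilityMeasure ν] {H : Ω → X} {Z : Ω → Y} (hH : Measurable H) (hZ : Measurable Z)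
    (hlaw : P.map Z = ν) (hind : IndepFun Z H P) {S : X → ℝ} (hS : Measurable S) {c : NNReal}
    (hsub : HasSubgaussianMGF (fun ω => S (H ω)) c P) {f : X → Y → ℝ}
    (hf : Measurable fun p : X × Y => f p.1 p.2) (hf1 : ∀ x y, |f x y| ≤ 1) :
    HasSubgaussianMGF (fun ω => S (H ω) + (f (H ω) (Z ω) - ∫ y, f (H ω) y ∂ν)) (c + 1) P := by
  set D : X → Y → ℝ := fun x y => f x y - ∫ y', f x y' ∂ν with hD
  have hm : Measurable fun x => ∫ y, f x y ∂ν :=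
    (StronglyMeasurable.integral_prod_right hf.stronglyMeasurable).measurable
  have hDm : Measurable fun p : X × Y => D p.1 p.2 := hf.sub (hm.comp measurable_fst)
  have hfm : ∀ x, Measurable (f x) := fun x => hf.comp (measurable_const.prodMk measurable_id)
  have hint1 : ∀ x, |∫ y, f x y ∂ν| ≤ 1 := fun x => by
    have := norm_integral_le_of_norm_le_const (μ := ν) (f := f x) (C := 1)
      (Filter.Eventually.of_forall fun y => hf1 x y)
    simpa using this
  have hD2 : ∀ x y, |D x y| ≤ 2 := fun x y => by
    have := abs_sub (f x y) (∫ y', f x y' ∂ν)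
    linarith [hf1 x y, hint1 x]
  have hDsub : ∀ x, HasSubgaussianMGF (D x) 1 ν := fun x => by
    -- Hoeffding's lemma: the variance proxy is the squared half-length of `[-1, 1]`.
    have := hasSubgaussianMGF_of_mem_Icc (μ := ν) (X := f x) (a := -1) (b := 1) (hfm x).aemeasurable
      (Filter.Eventually.of_forall fun y => abs_le.1 (hf1 x y))
    convert this using 1
    ext
    norm_num
  have hHZ : Measurable fun ω => (H ω, Z ω) := hH.prodMk hZ
  have hmap : P.map (fun ω => (H ω, Z ω)) = (P.map H).prod ν := by
    rw [(indepFun_iff_map_prod_eq_prod_map_map hH.aemeasurable hZ.aemeasurable).1 hind.symm, hlaw]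
  have : IsProbabilityMeasure (P.map H) := Measure.isProbabilityMeasure_map hH.aemeasurable
  have hint : ∀ t : ℝ, Integrable (fun ω => Real.exp (t * (S (H ω) + D (H ω) (Z ω)))) P := by
    intro t
    have h1 := hsub.integrable_exp_mul t
    have h2 : Measurable fun ω => Real.exp (t * D (H ω) (Z ω)) :=
      ((hDm.comp hHZ).const_mul t).exp
    refine (h1.mul_bdd (c := Real.exp (|t| * 2)) h2.aestronglyMeasurable
      (Filter.Eventually.of_forall fun ω => ?_)).congr (Filter.Eventually.of_forall fun ω => ?_)
    · rw [Real.norm_of_nonneg (Real.exp_pos _).le]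
      refine Real.exp_le_exp.2 ((le_abs_self _).trans ?_)
      rw [abs_mul]
      exact mul_le_mul_of_nonneg_left (hD2 _ _) (abs_nonneg t)
    · simp only [mul_add, Real.exp_add]
  refine ⟨hint, fun t => ?_⟩
  have hGm : Measurable fun p : X × Y => Real.exp (t * (S p.1 + D p.1 p.2)) := by
    exact (((hS.comp measurable_fst).add hDm).const_mul t).exp
  have hGint : Integrable (fun p : X × Y => Real.exp (t * (S p.1 + D p.1 p.2)))
      ((P.map H).prod ν) := by
    rw [← hmap, integrable_map_measure hGm.aestronglyMeasurable hHZ.aemeasurable]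
    exact hint t
  have hSm : Measurable fun x => Real.exp (t * S x) := (hS.const_mul t).exp
  have hSint : Integrable (fun x => Real.exp (t * S x)) (P.map H) := by
    rw [integrable_map_measure hSm.aestronglyMeasurable hH.aemeasurable]
    exact hsub.integrable_exp_mul t
  calc mgf (fun ω => S (H ω) + D (H ω) (Z ω)) P t
      = ∫ p, Real.exp (t * (S p.1 + D p.1 p.2)) ∂((P.map H).prod ν) := by
        rw [← hmap, integral_map hHZ.aemeasurable hGm.aestronglyMeasurable]
        rfl
    _ = ∫ x, ∫ y, Real.exp (t * (S x + D x y)) ∂ν ∂P.map H := integral_prod _ hGint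
    _ ≤ ∫ x, Real.exp (t * S x) * Real.exp (t ^ 2 / 2) ∂P.map H := by
        refine integral_mono hGint.integral_prod_left (hSint.mul_const _) fun x => ?_
        simp only [mul_add, Real.exp_add]
        rw [integral_const_mul]
        refine mul_le_mul_of_nonneg_left ?_ (Real.exp_pos _).le
        simpa [mgf] using (hDsub x).mgf_le t
    _ = mgf (fun ω => S (H ω)) P t * Real.exp (t ^ 2 / 2) := by
        rw [integral_mul_const, integral_map hH.aemeasurable hSm.aestronglyMeasurable]
        rfl
    _ ≤ Real.exp (c * t ^ 2 / 2) * Real.exp (t ^ 2 / 2) :=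
        mul_le_mul_of_nonneg_right (hsub.mgf_le t) (Real.exp_pos _).le
    _ = _ := by
        rw [← Real.exp_add]
        congr 1
        push_cast
        ring

/-- The sum of the deviations of `f_t(μ_0, …, μ_t, Z_t)` from their means over `Z_t` is sub-Gaussian
if `Z_t` is independent of the past and of `μ_0, …, μ_t`. -/
theorem hasSubgaussianMGF_sum_of_indepFun {Ω V Y : Type*} [MeasurableSpace Ω] [MeasurableSpace V]
    [MeasurableSpace Y] {P : Measure Ω} [IsProbabilityMeasure P] {ν : Measure Y}
    [IsProbabilityMeasure ν] {Z : ℕ → Ω → Y} {μ : ℕ → Ω → V} (hZ : ∀ t, Measurable (Z t))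
    (hμ : ∀ t, Measurable (μ t)) (hlaw : ∀ t, P.map (Z t) = ν)
    (hind : ∀ t, IndepFun (Z t)
      (fun ω => ((fun s : Fin t => Z s ω), (fun s : Fin (t + 1) => μ s ω))) P)
    {f : (t : ℕ) → (Fin (t + 1) → V) → Y → ℝ}
    (hf : ∀ t, Measurable fun p : (Fin (t + 1) → V) × Y => f t p.1 p.2)
    (hf1 : ∀ t x y, |f t x y| ≤ 1) (T : ℕ) :
    HasSubgaussianMGF (fun ω => ∑ t ∈ Finset.range T,
      (f t (fun s => μ s ω) (Z t ω) - ∫ y, f t (fun s => μ s ω) y ∂ν)) T P := by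
  induction T with
  | zero => simp
  | succ T ih =>
    let D : (t : ℕ) → (Fin (t + 1) → V) → Y → ℝ := fun t x y => f t x y - ∫ y', f t x y' ∂ν
    have hDm : ∀ t, Measurable fun p : (Fin (t + 1) → V) × Y => D t p.1 p.2 := fun t =>
      (hf t).sub ((StronglyMeasurable.integral_prod_right
        (hf t).stronglyMeasurable).measurable.comp measurable_fst)
    -- The earlier increments ignore `μ T`, but are written as a function of exactly the pair that
    -- `Z T` is independent of.
    let S : (Fin T → Y) × (Fin (T + 1) → V) → ℝ := fun p =>
      ∑ t : Fin T, D t (fun s => p.2 ⟨s, by omega⟩) (p.1 t)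
    have hS : Measurable S := by
      refine Finset.measurable_sum _ fun t _ => ?_
      have h : Measurable fun p : (Fin T → Y) × (Fin (T + 1) → V) =>
          ((fun s : Fin (t + 1) => p.2 ⟨s, by omega⟩), p.1 t) := by fun_prop
      exact (hDm t).comp h
    have hH : Measurable fun ω => ((fun s : Fin T => Z s ω), (fun s : Fin (T + 1) => μ s ω)) := by
      fun_prop
    have hfm : Measurable fun p : ((Fin T → Y) × (Fin (T + 1) → V)) × Y => f T p.1.2 p.2 := by
      have h : Measurable fun p : ((Fin T → Y) × (Fin (T + 1) → V)) × Y => (p.1.2, p.2) := by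
        fun_prop
      exact (hf T).comp h
    have key := hasSubgaussianMGF_add_of_indepFun hH (hZ T) (hlaw T) (hind T) hS (c := T)
      (f := fun p y => f T p.2 y)
      (ih.congr (Filter.Eventually.of_forall fun ω => by
        simp only [S, D]
        rw [Finset.sum_range])) hfm fun x y => hf1 T x.2 y
    rw [Nat.cast_succ]
    refine key.congr (Filter.Eventually.of_forall fun ω => ?_)
    simp only [S, D]
    rw [Finset.sum_range_succ, Finset.sum_range]

theorem one_sub_le_measure_of_hasSubgaussianMGF {Ω : Type*} [MeasurableSpace Ω] {P : Measure Ω}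
    [IsProbabilityMeasure P] {X : Ω → ℝ} {T : ℕ} (hT : 0 < T) (hX : HasSubgaussianMGF X T P)
    {δ : ℝ} (hδ : 0 < δ) (hδ1 : δ ≤ 1) :
    ENNReal.ofReal (1 - δ) ≤ P {ω | X ω ≤ Real.sqrt (2 * T * Real.log (1 / δ))} := by
  have hlog : 0 ≤ Real.log (1 / δ) := Real.log_nonneg ((one_le_div hδ).2 hδ1)
  have hT' : (0 : ℝ) < T := Nat.cast_pos.2 hT
  have hexp : Real.exp (-Real.sqrt (2 * T * Real.log (1 / δ)) ^ 2 / (2 * (T : NNReal))) = δ := by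
    rw [Real.sq_sqrt (by positivity), NNReal.coe_natCast, neg_div,
      mul_div_cancel_left₀ _ (by positivity), one_div, Real.log_inv, neg_neg, Real.exp_log hδ]
  have h1 := hX.measure_ge_le (Real.sqrt_nonneg (2 * T * Real.log (1 / δ)))
  rw [hexp] at h1
  generalize Real.sqrt (2 * T * Real.log (1 / δ)) = ε at h1 ⊢
  have h2 : P.real {ω | X ω ≤ ε}ᶜ ≤ δ :=
    (measureReal_mono (show {ω | X ω ≤ ε}ᶜ ⊆ {ω | ε ≤ X ω} from
      fun ω hω => (lt_of_not_ge (by simpa using hω)).le)).trans h1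
  have h3 : NullMeasurableSet {ω | X ω ≤ ε} P :=
    nullMeasurableSet_le hX.aemeasurable aemeasurable_const
  rw [measureReal_compl₀ h3, probReal_univ] at h2
  rw [← ofReal_measureReal]
  exact ENNReal.ofReal_le_ofReal (by linarith)

namespace CoalitionGame

/-! ### Rooted tree decompositions -/

namespace TreeDecomposition

variable {V κ : Type*} {G : SimpleGraph V} (D : TreeDecomposition G κ)

theorem not_isChild_root (r k : κ) : ¬ D.IsChild r k r := fun h => by
  have := h.2
  simp at this

/-- The parent is the second vertex of a geodesic from `l` to `r`. -/
theorem exists_isChild {r l : κ} (h : l ≠ r) : ∃ k, D.IsChild r k l := by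
  obtain ⟨p, hp⟩ := (D.isTree.connected l r).exists_walk_length_eq_dist
  cases p with
  | nil => exact absurd rfl h
  | @cons _ k _ hadj q =>
    refine ⟨k, hadj.symm, ?_⟩
    have h1 := SimpleGraph.dist_le q
    rw [SimpleGraph.Walk.length_cons] at hp
    have h3 : D.tree.dist r l = D.tree.dist l r := SimpleGraph.dist_comm
    have h4 : D.tree.dist r k = D.tree.dist k r := SimpleGraph.dist_comm
    rcases D.isTree.dist_eq_dist_add_one_of_adj r hadj with h2 | h2
    · exact h2
    · omega

/-- Two parents would start two different geodesics, hence paths, from `l` to `r`. -/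
theorem isChild_unique {r k k' l : κ} (h : D.IsChild r k l) (h' : D.IsChild r k' l) : k = k' := by
  obtain ⟨p, hp⟩ := (D.isTree.connected k r).exists_walk_length_eq_dist
  obtain ⟨p', hp'⟩ := (D.isTree.connected k' r).exists_walk_length_eq_dist
  have hq : (SimpleGraph.Walk.cons h.1.symm p).IsPath := by
    apply SimpleGraph.Walk.isPath_of_length_eq_dist
    rw [SimpleGraph.Walk.length_cons, hp, SimpleGraph.dist_comm, ← h.2, SimpleGraph.dist_comm]
  have hq' : (SimpleGraph.Walk.cons h'.1.symm p').IsPath := by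
    apply SimpleGraph.Walk.isPath_of_length_eq_dist
    rw [SimpleGraph.Walk.length_cons, hp', SimpleGraph.dist_comm, ← h'.2, SimpleGraph.dist_comm]
  have heq := (D.isTree.existsUnique_path l r).unique hq hq'
  simpa using congrArg (fun w => w.snd) heq

theorem isChild_or_isChild (r : κ) {k l : κ} (h : D.tree.Adj k l) :
    D.IsChild r k l ∨ D.IsChild r l k :=
  (D.isTree.dist_eq_dist_add_one_of_adj r h).elim (fun h1 => .inr ⟨h.symm, h1⟩)
    fun h1 => .inl ⟨h, h1⟩

open Classical in
-- Every node but the root is a child exactly once; this makes the dynamic program telescope.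
theorem sum_children [Fintype κ] (r : κ) (φ : κ → ℝ) :
    ∑ k, ∑ l : {l // D.IsChild r k l}, φ l + φ r = ∑ l, φ l := by
  have h1 : ∀ k, ∑ l : {l // D.IsChild r k l}, φ l = ∑ l, if D.IsChild r k l then φ l else 0 :=
    fun k => by
      rw [← Finset.sum_filter, Finset.sum_subtype (p := fun l => D.IsChild r k l) _ (by simp)]
  simp_rw [h1]
  rw [Finset.sum_comm, ← Finset.sum_erase_add _ _ (Finset.mem_univ r),
    ← Finset.sum_erase_add _ φ (Finset.mem_univ r)]
  have h2 : ∑ k, (if D.IsChild r k r then φ r else 0) = 0 :=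
    Finset.sum_eq_zero fun k _ => if_neg (D.not_isChild_root r k)
  rw [h2, add_zero]
  congr 1
  refine Finset.sum_congr rfl fun l hl => ?_
  obtain ⟨k, hk⟩ := D.exists_isChild (Finset.ne_of_mem_erase hl)
  rw [Finset.sum_eq_single k (fun k' _ hne => if_neg fun h => hne (D.isChild_unique h hk))
    (by simp), if_pos hk]

/-- Objects attached to the nodes of the rooted tree can be chosen from the root to the leaves. -/
theorem exists_top_down (r : κ) {X : κ → Type*} (x₀ : X r) (R : ∀ k l, X k → X l → Prop)
    (hR : ∀ k l, D.IsChild r k l → ∀ x, ∃ y, R k l x y) :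
    ∃ x : ∀ k, X k, x r = x₀ ∧ ∀ k l, D.IsChild r k l → R k l (x k) (x l) := by
  classical
  choose par hpar using fun (l : κ) (h : l ≠ r) => D.exists_isChild h
  choose next hnext using hR
  have hwf : WellFounded (D.IsChild r) :=
    Subrelation.wf (fun {k l} (h : D.IsChild r k l) => by
      change D.tree.dist r k < D.tree.dist r l
      have := h.2
      omega) (InvImage.wf (fun k => D.tree.dist r k) wellFounded_lt)
  let x : ∀ k, X k := hwf.fix fun l ih =>
    if h : l = r then h ▸ x₀ else next (par l h) l (hpar l h) (ih (par l h) (hpar l h))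
  refine ⟨x, ?_, fun k l hkl => ?_⟩
  · dsimp only [x]
    rw [WellFounded.fix_eq]
    simp
  · have hl : l ≠ r := fun h => D.not_isChild_root r k (h ▸ hkl)
    obtain rfl : par l hl = k := D.isChild_unique (hpar l hl) hkl
    have h1 : x l = next (par l hl) l (hpar l hl) (x (par l hl)) := by
      dsimp only [x]
      rw [WellFounded.fix_eq, dif_neg hl]
    rw [h1]
    exact hnext _ _ _ _

/-- Partial profiles on the bags that agree along the edges of the tree glue to a profile. -/
theorem exists_glue {A : V → Type*} (b : ∀ k, (i : D.bag k) → A i)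
    (hb : ∀ k l, D.tree.Adj k l → ∀ (i : V) (h : i ∈ D.bag k) (h' : i ∈ D.bag l),
      b k ⟨i, h⟩ = b l ⟨i, h'⟩) :
    ∃ a : (i : V) → A i, ∀ k, (D.bag k).restrict a = b k := by
  have key : ∀ (i : V) (k l : κ) (p : D.tree.Walk k l) (hp : ∀ m ∈ p.support, i ∈ D.bag m)
      (h : i ∈ D.bag k) (h' : i ∈ D.bag l), b k ⟨i, h⟩ = b l ⟨i, h'⟩ := by
    intro i k l p
    induction p with
    | nil => intros; rfl
    | cons hadj q ih =>
      intro hp h h'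
      have hm : i ∈ D.bag _ := hp _ (List.mem_cons_of_mem _ q.start_mem_support)
      exact (hb _ _ hadj i h hm).trans (ih (fun m hm => hp m (List.mem_cons_of_mem _ hm)) hm h')
  choose node hnode using D.cover
  refine ⟨fun i => b (node i) ⟨i, hnode i⟩, fun k => funext fun i => ?_⟩
  -- Running intersection: all bags along this path contain `i`, so agreement passes from edge to
  -- edge.
  obtain ⟨p, hp⟩ := (D.isTree.existsUnique_path (node i) k).exists
  exact key i _ _ p (D.path i _ _ (hnode i) i.2 p hp) (hnode i) i.2

end TreeDecomposition

theorem override_restrict {N : ℕ} {A : Fin N → Type*} (B : Finset (Fin N))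
    (a a' : (i : Fin N) → A i) {i : Fin N} (hi : i ∈ B) : override (B.restrict a) a' i = a i := by
  simp [override, hi]

/-! ### Local dependence of utilities, pure costs and the perturbed objective -/

namespace Game

universe u v

variable {N : ℕ} {A : Fin N → Type u} (G : Game A)

/-- Relevance concerns single-coordinate changes, so the coordinates are changed one at a time. -/
theorem utility_congr (i : Fin N) {a a' : (i : Fin N) → A i}
    (h : ∀ j ∈ G.relevant i, a j = a' j) : G.utility i a = G.utility i a' := by
  classical
  have key : ∀ s : Finset (Fin N),
      G.utility i a = G.utility i (fun j => if j ∈ s then a' j else a j) := by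
    intro s
    induction s using Finset.induction_on with
    | empty => simp
    | insert j s hj ih =>
      rw [ih]
      set c := fun j => if j ∈ s then a' j else a j with hc
      have h1 : (fun k => if k ∈ insert j s then a' k else a k) = Function.update c j (a' j) := by
        ext k
        by_cases hk : k = j
        · subst hk; simp
        · simp [hk, hc]
      have h2 : c = Function.update c j (a j) := by
        rw [eq_comm, Function.update_eq_self_iff]
        simp [hc, hj]
      rw [h1]
      by_cases hrel : j ∈ G.relevant i
      · rw [← h j hrel, ← h2]
      · by_contra hne
        exact hrel ⟨c, a j, a' j, by rwa [← h2]⟩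
  simpa using key Finset.univ

/-- The extensions of `b` to the bag `l` that the dynamic program minimizes over. -/
abbrev Agreeing {κ : Type v} (D : TreeDecomposition G.dependenceGraph κ) (k l : κ)
    (b : PartialProfile A (D.bag k)) : Type u :=
  {b' : PartialProfile A (D.bag l) //
    ∀ (i : Fin N) (h : i ∈ D.bag k) (h' : i ∈ D.bag l), b' ⟨i, h'⟩ = b ⟨i, h⟩}

theorem nonempty_agreeing [∀ i, Nonempty (A i)] {κ : Type v}
    {D : TreeDecomposition G.dependenceGraph κ} (k l : κ) (b : PartialProfile A (D.bag k)) :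
    Nonempty (G.Agreeing D k l b) :=
  ⟨⟨(D.bag l).restrict (extend b), fun i h h' => by simp [extend, override, h]⟩⟩

variable [∀ i, Fintype (A i)]

/-- The payoff of the mixed strategy `μ` of the deviator against the joint action `a`. -/
noncomputable def cost (μ : G.Deviation → ℝ) (a : (i : Fin N) → A i) : ℝ :=
  ∑ p : G.Deviation, μ p / (p.1.1.card : ℝ) *
    ∑ i ∈ p.1.1, (G.utility i (override p.2 a) - G.utility i a)

theorem payoff_eq_sum_cost (π : ((i : Fin N) → A i) → ℝ) (μ : G.Deviation → ℝ) :
    G.payoff π μ = ∑ a, π a * G.cost μ a := by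
  simp only [payoff, cost, Finset.mul_sum]
  rw [Finset.sum_comm]
  refine Finset.sum_congr rfl fun p _ => ?_
  rw [Finset.sum_comm]
  exact Finset.sum_congr rfl fun i _ => Finset.sum_congr rfl fun a _ => by ring

theorem abs_cost_le {μ : G.Deviation → ℝ} (hμ : μ ∈ stdSimplex ℝ G.Deviation)
    (a : (i : Fin N) → A i) : |G.cost μ a| ≤ 1 := by
  rw [← hμ.2]
  refine (Finset.abs_sum_le_sum_abs _ _).trans (Finset.sum_le_sum fun p _ => ?_)
  have hcard : (0 : ℝ) < p.1.1.card :=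
    Nat.cast_pos.2 (Finset.card_pos.2 (G.coalition_nonempty _ p.1.2))
  have h1 : |∑ i ∈ p.1.1, (G.utility i (override p.2 a) - G.utility i a)| ≤ p.1.1.card := by
    refine (Finset.abs_sum_le_sum_abs _ _).trans ?_
    refine (Finset.sum_le_card_nsmul _ _ 1 fun i _ => ?_).trans (by simp)
    have h2 := G.utility_mem i (override p.2 a)
    have h3 := G.utility_mem i a
    exact abs_le.2 ⟨by linarith [h2.1, h3.2], by linarith [h2.2, h3.1]⟩
  rw [abs_mul, abs_of_nonneg (div_nonneg (hμ.1 p) hcard.le), div_mul_eq_mul_div,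
    div_le_iff₀ hcard]
  exact mul_le_mul_of_nonneg_left h1 (hμ.1 p)

theorem measurable_cost : Measurable G.cost := by
  unfold cost
  fun_prop

variable {κ : Type v} [Fintype κ] {D : TreeDecomposition G.dependenceGraph κ}

theorem ftpl_objective_eq (μ : ℕ → G.Deviation → ℝ) (t : ℕ) (n : G.NoiseIndex D → ℝ)
    (ρ : ((i : Fin N) → A i) → ℝ) :
    ∑ s ∈ Finset.range t, G.payoff ρ (μ s) - ∑ a, G.totalNoise D n a * ρ a
      = ∑ a, ρ a * (∑ s ∈ Finset.range t, G.cost (μ s) a - G.totalNoise D n a) := by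
  simp only [payoff_eq_sum_cost, mul_sub, Finset.sum_sub_distrib, Finset.mul_sum]
  rw [Finset.sum_comm]
  simp only [mul_comm]

theorem isFTPLUpdate_single [∀ i, DecidableEq (A i)] {μ : ℕ → G.Deviation → ℝ} {t : ℕ}
    {n : G.NoiseIndex D → ℝ} {a : (i : Fin N) → A i}
    (h : ∀ a', ∑ s ∈ Finset.range t, G.cost (μ s) a - G.totalNoise D n a
      ≤ ∑ s ∈ Finset.range t, G.cost (μ s) a' - G.totalNoise D n a') :
    G.IsFTPLUpdate D μ t n (Pi.single a 1) := by
  refine ⟨single_mem_stdSimplex ℝ a, fun ρ hρ => ?_⟩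
  simp only [Set.mem_ofPred_eq, ftpl_objective_eq]
  simp only [Pi.single_apply, ite_mul, one_mul, zero_mul, Finset.sum_ite_eq', Finset.mem_univ,
    if_true]
  calc _ = ∑ b, ρ b * (∑ s ∈ Finset.range t, G.cost (μ s) a - G.totalNoise D n a) := by
        rw [← Finset.sum_mul, hρ.2, one_mul]
    _ ≤ _ := Finset.sum_le_sum fun b _ => mul_le_mul_of_nonneg_left (h b) (hρ.1 b)

/-- A decision of follow the perturbed leader is supported on minimizers. -/
theorem IsFTPLUpdate.isMin_of_ne_zero {μ : ℕ → G.Deviation → ℝ} {t : ℕ}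
    {n : G.NoiseIndex D → ℝ} {π : ((i : Fin N) → A i) → ℝ} (h : G.IsFTPLUpdate D μ t n π)
    {a : (i : Fin N) → A i} (ha : π a ≠ 0) (a' : (i : Fin N) → A i) :
    ∑ s ∈ Finset.range t, G.cost (μ s) a - G.totalNoise D n a
      ≤ ∑ s ∈ Finset.range t, G.cost (μ s) a' - G.totalNoise D n a' := by
  classical
  by_contra! hlt
  have : Nonempty ((i : Fin N) → A i) := ⟨a⟩
  -- Comparing with a global minimizer rather than `a'` makes every summand weakly ordered, and that
  -- of `a` strictly.
  obtain ⟨a₀, h₀⟩ := Finite.exists_min fun b =>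
    ∑ s ∈ Finset.range t, G.cost (μ s) b - G.totalNoise D n b
  have h1 := h.2 (single_mem_stdSimplex ℝ a₀)
  simp only [Set.mem_ofPred_eq, ftpl_objective_eq] at h1
  simp only [Pi.single_apply, ite_mul, one_mul, zero_mul, Finset.sum_ite_eq', Finset.mem_univ,
    if_true] at h1
  refine absurd h1 (not_le.2 ?_)
  calc _ = ∑ b, π b * (∑ s ∈ Finset.range t, G.cost (μ s) a₀ - G.totalNoise D n a₀) := by
        rw [← Finset.sum_mul, h.1.2, one_mul]
    _ < _ := Finset.sum_lt_sum (fun b _ => mul_le_mul_of_nonneg_left (h₀ b) (h.1.1 b))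
        ⟨a, Finset.mem_univ a, mul_lt_mul_of_pos_left ((h₀ a').trans_lt hlt)
          (lt_of_le_of_ne (h.1.1 a) ha.symm)⟩

/-! ### The dynamic program -/

variable [∀ i, Nonempty (A i)]

open Classical in
-- Each player is counted in one bag, which contains all players relevant to it, so the arbitrary
-- completion in `extend` has no effect.
theorem sum_localCost (assign : Fin N → κ) (hassign : ∀ i, G.relevant i ⊆ D.bag (assign i))
    (μ : ℕ → G.Deviation → ℝ) (t : ℕ) (a : (i : Fin N) → A i) :
    ∑ k, G.localCost D assign μ t k ((D.bag k).restrict a)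
      = ∑ s ∈ Finset.range t, G.cost (μ s) a := by
  simp only [localCost, cost]
  rw [Finset.sum_comm]
  refine Finset.sum_congr rfl fun s _ => ?_
  rw [Finset.sum_comm]
  refine Finset.sum_congr rfl fun p _ => ?_
  rw [← Finset.mul_sum, ← Finset.sum_fiberwise p.1.1 assign]
  congr 1
  refine Finset.sum_congr rfl fun k _ => Finset.sum_congr rfl fun i hi => ?_
  obtain ⟨-, rfl⟩ := Finset.mem_filter.1 hi
  have h1 : ∀ j ∈ G.relevant i, extend ((D.bag (assign i)).restrict a) j = a j := fun j hj =>
    override_restrict _ _ _ (hassign i hj)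
  congr 1
  · refine G.utility_congr i fun j hj => ?_
    simp only [override]
    split_ifs
    · rfl
    · exact h1 j hj
  · exact G.utility_congr i h1

variable (r : κ) (assign : Fin N → κ) (μ : ℕ → G.Deviation → ℝ) (t : ℕ) (n : G.NoiseIndex D → ℝ)

open Classical in
-- The restriction of `a` to a child bag is a candidate in that child's minimum.
theorem dpTable_restrict_le (k : κ) (a : (i : Fin N) → A i) :
    G.dpTable D r assign μ t n k ((D.bag k).restrict a)
      ≤ G.localCost D assign μ t k ((D.bag k).restrict a)
        + ∑ l : {l // D.IsChild r k l}, G.dpTable D r assign μ t n l.1 ((D.bag l.1).restrict a)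
        - n ⟨k, (D.bag k).restrict a⟩ := by
  rw [dpTable]
  gcongr with l
  exact ciInf_le (Set.finite_range _).bddBelow
    (⟨(D.bag l.1).restrict a, fun _ _ _ => rfl⟩ : G.Agreeing D k l.1 ((D.bag k).restrict a))

open Classical in
theorem IsDPOutput.dpTable_restrict_eq {a : (i : Fin N) → A i}
    (ha : G.IsDPOutput D r assign μ t n a) (k : κ) :
    G.dpTable D r assign μ t n k ((D.bag k).restrict a)
      = G.localCost D assign μ t k ((D.bag k).restrict a)
        + ∑ l : {l // D.IsChild r k l}, G.dpTable D r assign μ t n l.1 ((D.bag l.1).restrict a)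
        - n ⟨k, (D.bag k).restrict a⟩ := by
  refine (G.dpTable_restrict_le r assign μ t n k a).antisymm ?_
  conv_rhs => rw [dpTable]
  gcongr with l
  have := G.nonempty_agreeing k l.1 ((D.bag k).restrict a)
  exact le_ciInf fun b' => ha.2 k l.1 l.2 b'.1 fun i h h' => b'.2 i h' h

/-- Summed over all bags, the recursion makes the root entry equal to the objective at `a`, and at
most the objective at `a'`; the root entries are compared by hypothesis. -/
theorem IsDPOutput.isMin (hassign : ∀ i, G.relevant i ⊆ D.bag (assign i))
    {a : (i : Fin N) → A i} (ha : G.IsDPOutput D r assign μ t n a) (a' : (i : Fin N) → A i) :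
    ∑ s ∈ Finset.range t, G.cost (μ s) a - G.totalNoise D n a
      ≤ ∑ s ∈ Finset.range t, G.cost (μ s) a' - G.totalNoise D n a' := by
  classical
  have h1 := Finset.sum_congr rfl fun k (_ : k ∈ Finset.univ) =>
    IsDPOutput.dpTable_restrict_eq G r assign μ t n ha k
  have h2 := Finset.sum_le_sum fun k (_ : k ∈ Finset.univ) =>
    G.dpTable_restrict_le r assign μ t n k a'
  rw [Finset.sum_sub_distrib, Finset.sum_add_distrib, sum_localCost _ _ hassign] at h1 h2
  have h3 := D.sum_children r fun l => G.dpTable D r assign μ t n l ((D.bag l).restrict a)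
  have h4 := D.sum_children r fun l => G.dpTable D r assign μ t n l ((D.bag l).restrict a')
  have h5 := ha.1 ((D.bag r).restrict a')
  simp only [totalNoise]
  linarith

/-- Minimizers chosen from the root downwards agree along tree edges, hence glue. -/
theorem exists_isDPOutput : ∃ a, G.IsDPOutput D r assign μ t n a := by
  obtain ⟨b₀, h₀⟩ := Finite.exists_min (G.dpTable D r assign μ t n r)
  obtain ⟨b, hb, hbR⟩ := D.exists_top_down r (X := fun k => PartialProfile A (D.bag k)) b₀
    (fun k l x y => (∀ (i : Fin N) (h : i ∈ D.bag k) (h' : i ∈ D.bag l), y ⟨i, h'⟩ = x ⟨i, h⟩) ∧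
      ∀ z : G.Agreeing D k l x, G.dpTable D r assign μ t n l y ≤ G.dpTable D r assign μ t n l z.1)
    (fun k l _ x => by
      have := G.nonempty_agreeing k l x
      obtain ⟨y, hy⟩ := Finite.exists_min fun z : G.Agreeing D k l x =>
        G.dpTable D r assign μ t n l z.1
      exact ⟨y.1, y.2, hy⟩)
  obtain ⟨a, ha⟩ := D.exists_glue b fun k l hkl i h h' => by
    rcases D.isChild_or_isChild r hkl with hc | hc
    · exact ((hbR k l hc).1 i h h').symm
    · exact (hbR l k hc).1 i h' h
  refine ⟨a, fun b' => ?_, fun k l hkl b' hb' => ?_⟩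
  · rw [ha, hb]
    exact h₀ b'
  · rw [ha]
    refine (hbR k l hkl).2 ⟨b', fun i h h' => ?_⟩
    rw [hb' i h' h, ← ha k]
    rfl

end Game

end CoalitionGame

namespace CoalitionGame.Game

/-! ### The regret bound -/

universe u v

section

variable {N : ℕ} {A : Fin N → Type u} (G : Game A) {κ : Type v} [Fintype κ]
  (D : TreeDecomposition G.dependenceGraph κ)

/-- The noise coordinates `(B, a_B)` that enter the noise of the joint action `a`. -/
def noiseFeatures (a : (i : Fin N) → A i) : Finset (G.NoiseIndex D) :=
  Finset.univ.map ⟨fun k => ⟨k, (D.bag k).restrict a⟩, fun _ _ h => congrArg Sigma.fst h⟩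

theorem card_noiseFeatures (a : (i : Fin N) → A i) :
    (G.noiseFeatures D a).card = Fintype.card κ := by
  simp [noiseFeatures]

theorem mem_noiseFeatures {a : (i : Fin N) → A i} {j : G.NoiseIndex D} :
    j ∈ G.noiseFeatures D a ↔ ∃ k, (⟨k, (D.bag k).restrict a⟩ : G.NoiseIndex D) = j := by
  rw [noiseFeatures, Finset.mem_map]
  exact exists_congr fun k => and_iff_right (Finset.mem_univ k)

/-- A feature records its bag, so inclusion forces agreement on each bag, and the bags cover all
players. -/
theorem noiseFeatures_injective {a a' : (i : Fin N) → A i}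
    (h : G.noiseFeatures D a ⊆ G.noiseFeatures D a') : a = a' := by
  ext i
  obtain ⟨k, hk⟩ := D.cover i
  obtain ⟨k', hk'⟩ := (G.mem_noiseFeatures D).1 (h ((G.mem_noiseFeatures D).2 ⟨k, rfl⟩))
  obtain rfl : k' = k := congrArg Sigma.fst hk'
  exact (congrFun (eq_of_heq (Sigma.mk.inj hk').2) ⟨i, hk⟩).symm

theorem sum_noiseFeatures (n : G.NoiseIndex D → ℝ) (a : (i : Fin N) → A i) :
    ∑ j ∈ G.noiseFeatures D a, n j = G.totalNoise D n a :=
  Finset.sum_map _ _ _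

variable [∀ i, Fintype (A i)]

theorem log_card_partialProfile_le [∀ i, Nonempty (A i)] (k : κ) :
    Real.log (Fintype.card (PartialProfile A (D.bag k)))
      ≤ (D.width + 1) * Real.log (maxActions A) := by
  rw [Fintype.card_pi, Nat.cast_prod, Real.log_prod (fun i _ => by positivity)]
  have h1 : ∀ i : D.bag k, Real.log (Fintype.card (A i)) ≤ Real.log (maxActions A) := fun i =>
    Real.log_le_log (by positivity) (Nat.cast_le.2
      (Finset.le_sup (f := fun i => Fintype.card (A i)) (Finset.mem_univ i.1)))
  refine (Finset.sum_le_card_nsmul _ _ _ fun i _ => h1 i).trans ?_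
  rw [nsmul_eq_mul]
  refine mul_le_mul_of_nonneg_right ?_ (Real.log_natCast_nonneg _)
  have h2 : (D.bag k).card ≤ Finset.univ.sup fun k => (D.bag k).card :=
    Finset.le_sup (f := fun k => (D.bag k).card) (Finset.mem_univ k)
  -- Truncated subtraction in `width` can only enlarge the right-hand side.
  have h3 : (D.bag k).card ≤ D.width + 1 := by
    unfold TreeDecomposition.width
    omega
  rw [Finset.card_univ, Fintype.card_coe]
  exact_mod_cast h3

/-- An upper bound for the noise of all joint actions. -/
noncomputable def noiseBound (η : ℝ) (n : G.NoiseIndex D → ℝ) : ℝ :=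
  ∑ k, 2 / η * (Real.log (2 * Fintype.card (PartialProfile A (D.bag k))) - 1
    + (∑ b, Real.exp (η / 2 * n ⟨k, b⟩)) / (2 * Fintype.card (PartialProfile A (D.bag k))))

theorem totalNoise_le_noiseBound {η : ℝ} (hη : 0 < η) (n : G.NoiseIndex D → ℝ)
    (a : (i : Fin N) → A i) : G.totalNoise D n a ≤ G.noiseBound D η n :=
  Finset.sum_le_sum fun k _ => le_log_add_sum_exp hη (fun b => n ⟨k, b⟩) _

theorem integrable_noiseBound {η : ℝ} (hη : 0 < η) :
    Integrable (G.noiseBound D η) (expNoise (G.NoiseIndex D) η) := by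
  have := isProbabilityMeasure_expNoise (G.NoiseIndex D) hη
  exact integrable_finsetSum _ fun k _ => ((integrable_const _).add
    ((integrable_finsetSum _ fun b _ => integrable_exp_half_expNoise hη _).div_const _)).const_mul _

theorem integral_noiseBound_le [∀ i, Nonempty (A i)] {η : ℝ} (hη : 0 < η) :
    ∫ n, G.noiseBound D η n ∂expNoise (G.NoiseIndex D) η
      ≤ 2 * Fintype.card κ * ((1 + (D.width + 1) * Real.log (maxActions A)) / η) := by
  have := isProbabilityMeasure_expNoise (G.NoiseIndex D) hη
  have hint : ∀ k, Integrable (fun n : G.NoiseIndex D → ℝ =>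
      (∑ b, Real.exp (η / 2 * n ⟨k, b⟩)) / (2 * Fintype.card (PartialProfile A (D.bag k))))
      (expNoise (G.NoiseIndex D) η) := fun k =>
    (integrable_finsetSum _ fun b _ => integrable_exp_half_expNoise hη _).div_const _
  unfold noiseBound
  have hint' : ∀ k, Integrable (fun n : G.NoiseIndex D → ℝ =>
      2 / η * (Real.log (2 * Fintype.card (PartialProfile A (D.bag k))) - 1
        + (∑ b, Real.exp (η / 2 * n ⟨k, b⟩)) / (2 * Fintype.card (PartialProfile A (D.bag k)))))
      (expNoise (G.NoiseIndex D) η) := fun k => ((integrable_const _).add (hint k)).const_mul _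
  rw [integral_finsetSum _ fun k _ => hint' k]
  have hk : ∀ k, ∫ n : G.NoiseIndex D → ℝ,
      2 / η * (Real.log (2 * Fintype.card (PartialProfile A (D.bag k))) - 1
        + (∑ b, Real.exp (η / 2 * n ⟨k, b⟩)) / (2 * Fintype.card (PartialProfile A (D.bag k))))
        ∂expNoise (G.NoiseIndex D) η
      ≤ 2 / η * (1 + (D.width + 1) * Real.log (maxActions A)) := fun k => by
    have hM : (0 : ℝ) < Fintype.card (PartialProfile A (D.bag k)) := by positivity
    rw [integral_const_mul, integral_add (integrable_const _) (hint k), integral_const,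
      probReal_univ, one_smul, integral_div,
      integral_finsetSum _ fun b _ => integrable_exp_half_expNoise hη _]
    simp_rw [integral_exp_half_expNoise hη]
    rw [Finset.sum_const, Finset.card_univ, nsmul_eq_mul, mul_comm _ (2 : ℝ),
      div_self (by positivity), sub_add_cancel, Real.log_mul (by norm_num) hM.ne']
    have h1 := G.log_card_partialProfile_le D k
    -- The mean is `2 / η * log (2 * M)`, with `M` the number of joint actions of the bag; `log 2 <
    -- 1` gives the `1` in the bound.
    have h2 := Real.log_two_lt_d9
    refine mul_le_mul_of_nonneg_left ?_ (by positivity)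
    linarith
  refine (Finset.sum_le_sum fun k _ => hk k).trans (le_of_eq ?_)
  rw [Finset.sum_const, Finset.card_univ, nsmul_eq_mul]
  ring

/-- Against a fixed sequence of deviator strategies, the expected regret with fresh noise in every
round, with ties broken against the correlator. -/
theorem sum_expectedCost_sub_payoff_le [∀ i, Nonempty (A i)]
    (L : LeaderSelection ((i : Fin N) → A i)) {η : ℝ} (hη : 0 < η) {μ : ℕ → G.Deviation → ℝ}
    (hμ : ∀ t, μ t ∈ stdSimplex ℝ G.Deviation) (T : ℕ) {ρ : ((i : Fin N) → A i) → ℝ}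
    (hρ : ρ ∈ stdSimplex ℝ ((i : Fin N) → A i)) :
    ∑ t ∈ Finset.range T, expectedCost L (G.noiseFeatures D) η
        (∑ s ∈ Finset.range t, G.cost (μ s)) (G.cost (μ t))
      - ∑ t ∈ Finset.range T, G.payoff ρ (μ t)
      ≤ 2 * Fintype.card κ * ((1 + (D.width + 1) * Real.log (maxActions A)) / η)
        + 2 * η * Fintype.card κ * T := by
  have h1 := sum_expectedCost_le L hη (fun a a' => G.noiseFeatures_injective D)
    (G.card_noiseFeatures D) (c := fun t => G.cost (μ t)) (fun t a => G.abs_cost_le (hμ t) a)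
    (G.integrable_noiseBound D hη)
    (fun n a => (G.sum_noiseFeatures D n a).trans_le (G.totalNoise_le_noiseBound D hη n a)) T
  have h2 := G.integral_noiseBound_le D hη
  set E := ∑ t ∈ Finset.range T, expectedCost L (G.noiseFeatures D) η
    (∑ s ∈ Finset.range t, G.cost (μ s)) (G.cost (μ t))
  set B := 2 * Fintype.card κ * ((1 + (D.width + 1) * Real.log (maxActions A)) / η)
    + 2 * η * Fintype.card κ * T with hB
  have h3 : ∑ t ∈ Finset.range T, G.payoff ρ (μ t)
      = ∑ a, ρ a * ∑ t ∈ Finset.range T, G.cost (μ t) a := by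
    simp only [payoff_eq_sum_cost, Finset.mul_sum]
    rw [Finset.sum_comm]
  have h4 : E - B = ∑ a, ρ a * (E - B) := by rw [← Finset.sum_mul, hρ.2, one_mul]
  have h5 : E - B ≤ ∑ t ∈ Finset.range T, G.payoff ρ (μ t) := by
    rw [h3, h4]
    exact Finset.sum_le_sum fun a _ => mul_le_mul_of_nonneg_left (by linarith [h1 a]) (hρ.1 a)
  linarith

variable {D} in
-- The decision may be mixed and depend on the sample point non-measurably. It is supported on
-- minimizers, so the measurable leader with the costliest tie-breaking dominates it.
theorem IsFTPLUpdate.payoff_le (L : LeaderSelection ((i : Fin N) → A i))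
    {μ : ℕ → G.Deviation → ℝ} {t : ℕ} {n : G.NoiseIndex D → ℝ} {π : ((i : Fin N) → A i) → ℝ}
    (h : G.IsFTPLUpdate D μ t n π) (ν : G.Deviation → ℝ) :
    G.payoff π ν ≤ G.cost ν (L.leader
      (perturbedCost (G.noiseFeatures D) (∑ s ∈ Finset.range t, G.cost (μ s)) n) (G.cost ν)) := by
  set C := G.cost ν (L.leader
    (perturbedCost (G.noiseFeatures D) (∑ s ∈ Finset.range t, G.cost (μ s)) n) (G.cost ν))
  rw [payoff_eq_sum_cost]
  calc ∑ a, π a * G.cost ν a ≤ ∑ a, π a * C := by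
        refine Finset.sum_le_sum fun a _ => ?_
        by_cases ha : π a = 0
        · simp [ha]
        · refine mul_le_mul_of_nonneg_left (L.tie_le _ _ a fun a' => ?_) (h.1.1 a)
          simpa only [perturbedCost, sum_noiseFeatures, Finset.sum_apply] using
            IsFTPLUpdate.isMin_of_ne_zero G h ha a'
    _ = C := by rw [← Finset.sum_mul, h.1.2, one_mul]

/-- The cost truncated to `[-1, 1]`, which is the cost if `μ` is a probability vector. -/
noncomputable def truncatedCost (μ : G.Deviation → ℝ) (a : (i : Fin N) → A i) : ℝ :=
  max (-1) (min 1 (G.cost μ a))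

theorem abs_truncatedCost_le (μ : G.Deviation → ℝ) (a : (i : Fin N) → A i) :
    |G.truncatedCost μ a| ≤ 1 :=
  abs_le.2 ⟨le_max_left _ _, max_le (by norm_num) (min_le_left _ _)⟩

theorem truncatedCost_eq {μ : G.Deviation → ℝ} (hμ : μ ∈ stdSimplex ℝ G.Deviation) :
    G.truncatedCost μ = G.cost μ := by
  ext a
  have h := abs_le.1 (G.abs_cost_le hμ a)
  rw [truncatedCost, min_eq_right h.2, max_eq_right h.1]

theorem measurable_truncatedCost : Measurable G.truncatedCost := by
  refine measurable_pi_lambda _ fun a => ?_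
  exact measurable_const.max (measurable_const.min ((measurable_pi_apply a).comp G.measurable_cost))

end

theorem regret_le {N : ℕ} {A : Fin N → Type u} [∀ i, Fintype (A i)] [∀ i, Nonempty (A i)]
    (G : Game A) {κ : Type v} [Fintype κ] (D : TreeDecomposition G.dependenceGraph κ)
    {η : ℝ} (hη : 0 < η) {Ω : Type*} [MeasurableSpace Ω] (P : Measure Ω) [IsProbabilityMeasure P]
    (noise : ℕ → Ω → G.NoiseIndex D → ℝ) (μ : ℕ → Ω → G.Deviation → ℝ)
    (π : ℕ → Ω → ((i : Fin N) → A i) → ℝ)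
    (noise_measurable : ∀ t, Measurable (noise t))
    (noise_law : ∀ t, HasLaw (noise t) (expNoise (G.NoiseIndex D) η) P)
    (μ_measurable : ∀ t, Measurable (μ t))
    (μ_mem : ∀ t ω, μ t ω ∈ stdSimplex ℝ G.Deviation)
    (noise_indep : ∀ t, IndepFun (noise t)
      (fun ω => ((fun s : Fin t => noise s ω), (fun s : Fin (t + 1) => μ s ω))) P)
    (π_update : ∀ t ω, G.IsFTPLUpdate D (fun s => μ s ω) t (noise t ω) (π t ω))
    (T : ℕ) {δ : ℝ} (hδ : 0 < δ) :
    ENNReal.ofReal (1 - δ) ≤ P {ω | ∀ ρ ∈ stdSimplex ℝ ((i : Fin N) → A i),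
      ∑ t ∈ Finset.range T, (G.payoff (π t ω) (μ t ω) - G.payoff ρ (μ t ω)) ≤
        regretBound (Fintype.card κ) D.width (maxActions A) T η δ} := by
  rcases lt_or_ge 1 δ with hδ1 | hδ1
  · rw [ENNReal.ofReal_of_nonpos (by linarith)]
    exact zero_le
  have hν := isProbabilityMeasure_expNoise (G.NoiseIndex D) hη
  obtain ⟨L⟩ := nonempty_leaderSelection ((i : Fin N) → A i)
  -- Truncation makes `f` bounded at every `x`, not only at probability vectors. The last entry of
  -- `x` is the current deviation; the others form the past.
  let f : (t : ℕ) → (Fin (t + 1) → G.Deviation → ℝ) → (G.NoiseIndex D → ℝ) → ℝ := fun t x n =>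
    G.truncatedCost (x (Fin.last t)) (L.leader (perturbedCost (G.noiseFeatures D)
      (∑ s : Fin t, G.truncatedCost (x s.castSucc)) n) (G.truncatedCost (x (Fin.last t))))
  have hf : ∀ t, Measurable fun p : (Fin (t + 1) → G.Deviation → ℝ) × (G.NoiseIndex D → ℝ) =>
      f t p.1 p.2 := fun t => by
    have hx : ∀ s, Measurable fun p : (Fin (t + 1) → G.Deviation → ℝ) × (G.NoiseIndex D → ℝ) =>
        G.truncatedCost (p.1 s) := fun s =>
      G.measurable_truncatedCost.comp ((measurable_pi_apply s).comp measurable_fst)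
    exact L.measurable_apply (measurable_perturbedCost _
      (Finset.measurable_sum _ fun s _ => hx _) measurable_snd) (hx _) (hx _)
  have hfμ : ∀ t ω n, f t (fun s => μ s ω) n = G.cost (μ t ω) (L.leader
      (perturbedCost (G.noiseFeatures D) (∑ s ∈ Finset.range t, G.cost (μ s ω)) n)
      (G.cost (μ t ω))) := fun t ω n => by
    simp only [f, G.truncatedCost_eq (μ_mem _ ω), Fin.val_last, Fin.val_castSucc]
    rw [Finset.sum_range]
  have hsub := hasSubgaussianMGF_sum_of_indepFun noise_measurable μ_measurable
    (fun t => (noise_law t).map_eq) noise_indep hf (fun t x n => G.abs_truncatedCost_le _ _) T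
  have key : ∀ ω, ∑ t ∈ Finset.range T, (f t (fun s => μ s ω) (noise t ω)
        - ∫ n, f t (fun s => μ s ω) n ∂expNoise (G.NoiseIndex D) η)
        ≤ Real.sqrt (2 * T * Real.log (1 / δ)) →
      ∀ ρ ∈ stdSimplex ℝ ((i : Fin N) → A i),
        ∑ t ∈ Finset.range T, (G.payoff (π t ω) (μ t ω) - G.payoff ρ (μ t ω)) ≤
          regretBound (Fintype.card κ) D.width (maxActions A) T η δ := by
    intro ω hω ρ hρ
    simp only [hfμ] at hω
    have h1 := G.sum_expectedCost_sub_payoff_le D L hη (fun t => μ_mem t ω) T hρ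
    have h2 := Finset.sum_le_sum fun t (_ : t ∈ Finset.range T) =>
      IsFTPLUpdate.payoff_le G L (π_update t ω) (μ t ω)
    rw [Finset.sum_sub_distrib] at hω ⊢
    simp only [expectedCost] at h1
    unfold regretBound
    linarith
  -- For `T = 0` the tail bound would divide by zero, but the deviation sum is empty.
  rcases Nat.eq_zero_or_pos T with rfl | hT
  · refine (ENNReal.ofReal_le_one.2 (by linarith)).trans ?_
    rw [← measure_univ (μ := P)]
    exact measure_mono fun ω _ => key ω (by simp)
  · exact (one_sub_le_measure_of_hasSubgaussianMGF hT hsub hδ hδ1).trans (measure_mono key)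

end CoalitionGame.Game

/-- Rounds are numbered from `0`. In round `t` the correlator draws the noise `noise t`, whose
coordinates are independent `Exp(η)` variables, and plays a minimizer `π t`; the deviator is an
arbitrary adaptive one: the noise of round `t` is independent of the past noise and of the
strategies `μ 0, …, μ t` played up to and including round `t`. -/
theorem mainTheorem5 {N : ℕ} {A : Fin N → Type*} [∀ i, Fintype (A i)] [∀ i, Nonempty (A i)]
    [∀ i, DecidableEq (A i)] (G : CoalitionGame.Game A)
    {κ : Type*} [Fintype κ] (D : CoalitionGame.TreeDecomposition G.dependenceGraph κ)
    {η : ℝ} (hη : 0 < η)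
    {Ω : Type*} [MeasurableSpace Ω] (P : Measure Ω) [IsProbabilityMeasure P]
    (noise : ℕ → Ω → G.NoiseIndex D → ℝ)
    (μ : ℕ → Ω → G.Deviation → ℝ)
    (π : ℕ → Ω → ((i : Fin N) → A i) → ℝ)
    (noise_measurable : ∀ t, Measurable (noise t))
    (noise_law : ∀ t, HasLaw (noise t) (Measure.pi fun _ => expMeasure η) P)
    (μ_measurable : ∀ t, Measurable (μ t))
    (μ_mem : ∀ t ω, μ t ω ∈ stdSimplex ℝ G.Deviation)
    (noise_indep : ∀ t, IndepFun (noise t)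
      (fun ω => ((fun s : Fin t => noise s ω), (fun s : Fin (t + 1) => μ s ω))) P)
    (π_update : ∀ t ω, G.IsFTPLUpdate D (fun s => μ s ω) t (noise t ω) (π t ω)) :
    -- the regret bound, in terms of the width of the given tree decomposition
    (∀ (T : ℕ) (δ : ℝ), 0 < δ →
      ENNReal.ofReal (1 - δ) ≤ P {ω | ∀ ρ ∈ stdSimplex ℝ ((i : Fin N) → A i),
        ∑ t ∈ Finset.range T, (G.payoff (π t ω) (μ t ω) - G.payoff ρ (μ t ω)) ≤
          CoalitionGame.Game.regretBound (Fintype.card κ) D.width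
            (CoalitionGame.maxActions A) T η δ}) ∧
    -- the regret bound in terms of the treewidth, for a tree decomposition of minimum width
    (D.width = CoalitionGame.treewidth G.dependenceGraph → ∀ (T : ℕ) (δ : ℝ), 0 < δ →
      ENNReal.ofReal (1 - δ) ≤ P {ω | ∀ ρ ∈ stdSimplex ℝ ((i : Fin N) → A i),
        ∑ t ∈ Finset.range T, (G.payoff (π t ω) (μ t ω) - G.payoff ρ (μ t ω)) ≤
          CoalitionGame.Game.regretBound (Fintype.card κ)
            (CoalitionGame.treewidth G.dependenceGraph) (CoalitionGame.maxActions A) T η δ}) ∧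
    -- the dynamic program computes the update, whatever the root, the assignment and the ties
    (∀ (r : κ) (assign : Fin N → κ), (∀ i, G.relevant i ⊆ D.bag (assign i)) → ∀ (t : ℕ) (ω : Ω),
      (∃ a, G.IsDPOutput D r assign (fun s => μ s ω) t (noise t ω) a) ∧
      ∀ a, G.IsDPOutput D r assign (fun s => μ s ω) t (noise t ω) a →
        G.IsFTPLUpdate D (fun s => μ s ω) t (noise t ω) (Pi.single a 1)) := by
  have key := CoalitionGame.Game.regret_le G D hη P noise μ π noise_measurable noise_law
    μ_measurable μ_mem noise_indep π_update
  refine ⟨fun T δ hδ => key T hδ, fun hw T δ hδ => hw ▸ key T hδ,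
    fun r assign hassign t ω => ⟨G.exists_isDPOutput r assign _ t _, fun a ha =>
      G.isFTPLUpdate_single (ha.isMin G r assign _ t _ hassign)⟩⟩
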